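/- Let $N^{m+1}(c)$ be a space form, that is, a Riemannian manifold of dimension $m+1$ and constant sectional curvature $c\in\mathbb{R}$ (curvature tensor $R(X,Y)Z=c(\langle Y,Z\rangle X-\langle X,Z\rangle Y)$; completeness is not required), let $M^m$ be a connected Riemannian manifold, without boundary, and let $\phi:M^m\to N^{m+1}(c)$ be a smooth isometric immersion (a hypersurface). Let $\tau(\phi)=\operatorname{trace}\nabla d\phi$ be its tension field, and let $$S_2(X,Y)=\tfrac12|\tau(\phi)|^2\langle X,Y\rangle+\langle d\phi,\nabla\tau(\phi)\rangle\langle X,Y\rangle-\langle d\phi(X),\nabla_Y\tau(\phi)\rangle-\langle d\phi(Y),\nabla_X\tau(\phi)\rangle$$ be the stress-energy tensor of the bienergy, where $\nabla\tau(\phi)$ is taken with the pull-back connection on $\phi^{-1}(TN)$ and $\langle d\phi,\nabla\tau(\phi)\rangle=\sum_i\langle d\phi(e_i),\nabla_{e_i}\tau(\phi)\rangle$ for an orthonormal basis $\{e_i\}$. Let $A$ be the shape operator, defined for a local smooth unit normal field $\eta$ by $d\phi(AX)=-\nabla_X\eta$ (the condition $\nabla A=0$ does not depend on the choice of $\eta$,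 which is unique locally up to sign; it means that $\nabla A=0$ for every local smooth unit normal field). Assume that $\phi$ is non-minimal, i.e. the mean curvature vector field $H=\frac1m\tau(\phi)$ does not vanish identically. Then $\nabla S_2=0$ on $M$ if and only if $\nabla A=0$ on $M$. -/

import Mathlib

open Bundle Set
open scoped Manifold ContDiff Topology

noncomputable section

namespace RiemannianHypersurface

section LeviCivita

/-! ### The Levi-Civita connection, directly and along a map -/

variable {n : ℕ} {N : Type*} [TopologicalSpace N]
  [ChartedSpace (EuclideanSpace ℝ (Fin n)) N] [IsManifold (𝓡 n) ∞ N]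

instance finiteDimensional_tangentSpace (q : N) :
    FiniteDimensional ℝ (TangentSpace (𝓡 n) q) :=
  inferInstanceAs (FiniteDimensional ℝ (EuclideanSpace ℝ (Fin n)))

/-- The vector field `X` is smooth near the point `q`. -/
def SmoothFieldAt (X : ∀ y : N, TangentSpace (𝓡 n) y) (q : N) : Prop :=
  ContMDiffAt (𝓡 n) (𝓡 n).tangent ∞ (fun y => (⟨y, X y⟩ : TangentBundle (𝓡 n) N)) q

/-- The vector field with constant coordinates, in the preferred chart at `q`, which takes the
value `u` at `q`. -/
def coordField (q : N) (u : TangentSpace (𝓡 n) q) (y : N) : TangentSpace (𝓡 n) y :=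
  FiberBundle.extend (EuclideanSpace ℝ (Fin n)) u y

variable [RiemannianBundle (fun y : N => TangentSpace (𝓡 n) y)]

/-- An orthonormal basis of the tangent space at `q`. Everything below that is defined with its
help (metric duals and traces) does not depend on the choice of the basis. -/
def frame (q : N) :
    OrthonormalBasis (Fin (Module.finrank ℝ (TangentSpace (𝓡 n) q))) ℝ (TangentSpace (𝓡 n) q) :=
  stdOrthonormalBasis ℝ (TangentSpace (𝓡 n) q)

/-- The derivative at `q`, in the direction `w`, of the metric coefficient `⟨u, v⟩`, where `u`, `v`
are extended with constant coordinates in the chart at `q`. -/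
def metricDeriv (q : N) (w u v : TangentSpace (𝓡 n) q) : ℝ :=
  mvfderiv (𝓡 n) (fun y : N => (inner ℝ (coordField q u y) (coordField q v y) : ℝ)) q w

/-- The Christoffel symbols of the metric at `q`, in the chart at `q`: the vector `Γ(u, v)` with
`⟨Γ(u, v), w⟩ = (∂_u ⟨v, w⟩ + ∂_v ⟨u, w⟩ - ∂_w ⟨u, v⟩) / 2` for all `w`. -/
def christoffel (q : N) (u v : TangentSpace (𝓡 n) q) : TangentSpace (𝓡 n) q :=
  ∑ k, ((metricDeriv q u v (frame q k) + metricDeriv q v u (frame q k)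
    - metricDeriv q (frame q k) u v) / 2) • frame q k

variable {m : ℕ} {M : Type*} [TopologicalSpace M]
  [ChartedSpace (EuclideanSpace ℝ (Fin m)) M] [IsManifold (𝓡 m) ∞ M]

/-- The covariant derivative `∇^F_v V` at `x` of a section `V` of `F⁻¹(TN)`, a vector field along
the map `F : M → N`, for the pull-back of the Levi-Civita connection of `N`. In the coordinates
of the charts at `x` and at `F x` it is `∂_v V^k + Γ^k_{ij} (dF v)^i V^j`. -/
def covAlong (F : M → N) (V : ∀ y : M, TangentSpace (𝓡 n) (F y)) (x : M)
    (v : TangentSpace (𝓡 m) x) : TangentSpace (𝓡 n) (F x) :=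
  let e := trivializationAt (EuclideanSpace ℝ (Fin n)) (TangentSpace (𝓡 n) : N → Type _) (F x)
  e.symm (F x) (mvfderiv (𝓡 m) (fun y : M => (e (⟨F y, V y⟩ : TangentBundle (𝓡 n) N)).2) x v)
    + christoffel (F x) (mfderiv (𝓡 m) (𝓡 n) F x v) (V x)

/-- The Levi-Civita connection of `N`: `leviCivita X q v` is `∇_v X` at `q`. -/
def leviCivita (X : ∀ y : N, TangentSpace (𝓡 n) y) (q : N) (v : TangentSpace (𝓡 n) q) :
    TangentSpace (𝓡 n) q :=
  covAlong (fun y : N => y) X q v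

/-- The curvature `R(X, Y)Z = ∇_X ∇_Y Z - ∇_Y ∇_X Z - ∇_{[X, Y]} Z`. -/
def curvature (X Y Z : ∀ y : N, TangentSpace (𝓡 n) y) (q : N) : TangentSpace (𝓡 n) q :=
  leviCivita (fun y => leviCivita Z y (Y y)) q (X q)
    - leviCivita (fun y => leviCivita Z y (X y)) q (Y q)
    - leviCivita Z q (VectorField.mlieBracket (𝓡 n) X Y q)

variable (n N) in
/-- The Riemannian manifold `N` has constant (sectional) curvature `c`:
`R(X, Y)Z = c (⟨Y, Z⟩ X - ⟨X, Z⟩ Y)` for all vector fields. -/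
def HasConstantCurvature (c : ℝ) : Prop :=
  ∀ (q : N) (X Y Z : ∀ y : N, TangentSpace (𝓡 n) y),
    SmoothFieldAt X q → SmoothFieldAt Y q → SmoothFieldAt Z q →
      curvature X Y Z q
        = c • ((inner ℝ (Y q) (Z q) : ℝ) • X q - (inner ℝ (X q) (Z q) : ℝ) • Y q)

/-- The covariant derivative `(∇_v S)(Y, Z) = v(S(Y, Z)) - S(∇_v Y, Z) - S(Y, ∇_v Z)` at `q` of a
2-covariant tensor `S`. -/
def nablaBilin (S : ∀ y : N, TangentSpace (𝓡 n) y → TangentSpace (𝓡 n) y → ℝ) (q : N)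
    (v : TangentSpace (𝓡 n) q) (Y Z : ∀ y : N, TangentSpace (𝓡 n) y) : ℝ :=
  mvfderiv (𝓡 n) (fun y : N => S y (Y y) (Z y)) q v
    - S q (leviCivita Y q v) (Z q) - S q (Y q) (leviCivita Z q v)

/-- The covariant derivative `(∇_v A)(Y) = ∇_v (A Y) - A (∇_v Y)` at `q` of a
`(1,1)`-tensor `A`. -/
def nablaEnd (A : ∀ y : N, TangentSpace (𝓡 n) y → TangentSpace (𝓡 n) y) (q : N)
    (v : TangentSpace (𝓡 n) q) (Y : ∀ y : N, TangentSpace (𝓡 n) y) : TangentSpace (𝓡 n) q :=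
  leviCivita (fun y => A y (Y y)) q v - A q (leviCivita Y q v)

end LeviCivita

section Maps

/-! ### Tension field, stress-energy tensor of the bienergy, shape operator -/

variable (m n : ℕ)
  {M : Type*} [TopologicalSpace M] [ChartedSpace (EuclideanSpace ℝ (Fin m)) M]
  [IsManifold (𝓡 m) ∞ M] [RiemannianBundle (fun x : M => TangentSpace (𝓡 m) x)]
  {N : Type*} [TopologicalSpace N] [ChartedSpace (EuclideanSpace ℝ (Fin n)) N]
  [IsManifold (𝓡 n) ∞ N] [RiemannianBundle (fun y : N => TangentSpace (𝓡 n) y)]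

/-- `φ` is a smooth isometric immersion (injectivity of `dφ` follows). -/
structure IsIsometricImmersion (φ : M → N) : Prop where
  smooth : ContMDiff (𝓡 m) (𝓡 n) ∞ φ
  isometric : ∀ (x : M) (v w : TangentSpace (𝓡 m) x),
    (inner ℝ (mfderiv (𝓡 m) (𝓡 n) φ x v) (mfderiv (𝓡 m) (𝓡 n) φ x w) : ℝ) = inner ℝ v w

/-- `(∇dφ)(v, w) = ∇^φ_v (dφ W) - dφ(∇_v W)` at `x`, where `W` extends `w`. -/
def secondFundamentalForm (φ : M → N) (x : M) (v w : TangentSpace (𝓡 m) x) :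
    TangentSpace (𝓡 n) (φ x) :=
  covAlong φ (fun y => mfderiv (𝓡 m) (𝓡 n) φ y (coordField x w y)) x v
    - mfderiv (𝓡 m) (𝓡 n) φ x (leviCivita (coordField x w) x v)

/-- The tension field `τ(φ) = trace ∇dφ`. -/
def tension (φ : M → N) (x : M) : TangentSpace (𝓡 n) (φ x) :=
  ∑ i, secondFundamentalForm m n φ x (frame x i) (frame x i)

/-- The mean curvature vector field `H = (1/m) τ(φ)`. -/
def meanCurvature (φ : M → N) (x : M) : TangentSpace (𝓡 n) (φ x) :=
  (1 / (m : ℝ)) • tension m n φ x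

/-- `φ` is minimal: its mean curvature vanishes identically. -/
def IsMinimal (φ : M → N) : Prop := ∀ x : M, meanCurvature m n φ x = 0

/-- The stress-energy tensor of the bienergy,
`S₂(X, Y) = (|τ|² / 2) ⟨X, Y⟩ + ⟨dφ, ∇τ⟩ ⟨X, Y⟩ - ⟨dφ X, ∇_Y τ⟩ - ⟨dφ Y, ∇_X τ⟩`. -/
def stressEnergy₂ (φ : M → N) (x : M) (X Y : TangentSpace (𝓡 m) x) : ℝ :=
  1 / 2 * ‖tension m n φ x‖ ^ 2 * inner ℝ X Y
    + (∑ i, inner ℝ (mfderiv (𝓡 m) (𝓡 n) φ x (frame x i))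
        (covAlong φ (tension m n φ) x (frame x i))) * inner ℝ X Y
    - inner ℝ (mfderiv (𝓡 m) (𝓡 n) φ x X) (covAlong φ (tension m n φ) x Y)
    - inner ℝ (mfderiv (𝓡 m) (𝓡 n) φ x Y) (covAlong φ (tension m n φ) x X)

/-- `S₂` is parallel: `∇S₂ = 0` on `M`. -/
def StressEnergyParallel (φ : M → N) : Prop :=
  ∀ (x : M) (v : TangentSpace (𝓡 m) x) (Y Z : ∀ y : M, TangentSpace (𝓡 m) y),
    SmoothFieldAt Y x → SmoothFieldAt Z x → nablaBilin (stressEnergy₂ m n φ) x v Y Z = 0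

/-- `η` is a smooth unit normal vector field of the immersion `φ` over `U`. -/
structure IsUnitNormalOn (φ : M → N) (η : ∀ x : M, TangentSpace (𝓡 n) (φ x)) (U : Set M) :
    Prop where
  smooth : ContMDiffOn (𝓡 m) (𝓡 n).tangent ∞
    (fun x => (⟨φ x, η x⟩ : TangentBundle (𝓡 n) N)) U
  unit : ∀ x ∈ U, ‖η x‖ = 1
  normal : ∀ x ∈ U, ∀ v : TangentSpace (𝓡 m) x,
    (inner ℝ (mfderiv (𝓡 m) (𝓡 n) φ x v) (η x) : ℝ) = 0

/-- The shape operator in the direction of the normal field `η`: `dφ(A v)` is the tangential part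
of `-∇^φ_v η`, that is, `⟨A v, w⟩ = -⟨∇^φ_v η, dφ w⟩` for all `w`. -/
def shapeOperator (φ : M → N) (η : ∀ x : M, TangentSpace (𝓡 n) (φ x)) (x : M)
    (v : TangentSpace (𝓡 m) x) : TangentSpace (𝓡 m) x :=
  -∑ i, (inner ℝ (covAlong φ η x v) (mfderiv (𝓡 m) (𝓡 n) φ x (frame x i)) : ℝ) • frame x i

/-- The shape operator of a hypersurface is parallel: `∇A = 0` on `M`. The shape operator is
determined by a choice of a unit normal field, which exists near every point and is unique
there up to sign; the condition is imposed on each local unit normal field. -/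
def ShapeOperatorParallel (φ : M → N) : Prop :=
  ∀ (U : Set M) (η : ∀ x : M, TangentSpace (𝓡 n) (φ x)), IsOpen U → IsUnitNormalOn m n φ η U →
    ∀ x ∈ U, ∀ (v : TangentSpace (𝓡 m) x) (Y : ∀ y : M, TangentSpace (𝓡 m) y),
      SmoothFieldAt Y x → nablaEnd (shapeOperator m n φ η) x v Y = 0

end Maps

end RiemannianHypersurface

end

open Bundle Set
open scoped Manifold ContDiff Topology

noncomputable section

set_option linter.unusedSectionVars false

/-! The tension field of an isometric immersion is normal, so Weingarten's formula gives `S₂ =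
-(|τ|²/2) g + 2⟨B, τ⟩`, with `B` the second fundamental form (`stressEnergy₂_eq`). On a hypersurface
with local unit normal `η` write `τ = t η`, so that `t = tr A` (`normalTension`). Then `S₂ = -(t²/2)
g + 2 t A` and `∇S₂ = dt ⊗ (2A - t g) + 2 t ∇A` (`IsUnitNormalOn.nablaBilin_stressEnergy₂`).

If `∇A = 0`, then `dt = tr ∇A = 0` wherever `τ ≠ 0`. Hence `|τ|²` is a nonzero constant on the
connected manifold `M` (`tension_ne_zero`), the normal `τ/|τ|` is defined everywhere, and both terms
of `∇S₂` vanish.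

Conversely, let `∇S₂ = 0`, so that `2t ∇A = dt ⊗ b` with `b = t g - 2A`. The point is that `dt = 0`
wherever `t ≠ 0`. Suppose `dt ≠ 0` at such a point. In constant curvature the Codazzi equation
(`IsUnitNormalOn.codazzi`) makes `dt ⊗ b` symmetric in all arguments. Its trace forces `m = 4`, and
`b` has rank one, so `|b|² = (tr b)²`, which for `m = 4` says `|A|² = t²` (`sum_sq_eq_of_codazzi`).
This holds in a neighbourhood, so it may be differentiated: `⟨∇A, A⟩ = t dt`. Pairing `2t ∇A = dt ⊗
b` with `A` gives `2t ⟨∇A, A⟩ = (t² - 2|A|²) dt = -t² dt`. Together these yield `3 t² dt = 0`, a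
contradiction. So `|τ|²` is again a nonzero constant, and `2t ∇A = 0` gives `∇A = 0`.

Most of the file supplies the Riemannian geometry behind this: metric compatibility, vanishing
torsion, smooth orthonormal frames, Koszul's formula, and the curvature of the pull-back connection.
The coordinate definition of `covAlong` changes its chart with the base point, so smoothness of
covariant derivatives is obtained from Koszul's formula and frames. -/

namespace RiemannianHypersurface

/-! ### Vector fields along a map: regularity and coordinates. -/

section Along

variable {n : ℕ} {N : Type*} [TopologicalSpace N]
  [ChartedSpace (EuclideanSpace ℝ (Fin n)) N] [IsManifold (𝓡 n) ∞ N]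
  {m : ℕ} {M : Type*} [TopologicalSpace M]
  [ChartedSpace (EuclideanSpace ℝ (Fin m)) M] [IsManifold (𝓡 m) ∞ M]

variable (m) in
/-- The vector field `V` along `F` is differentiable at `x`. -/
def DiffAlongAt (F : M → N) (V : ∀ y : M, TangentSpace (𝓡 n) (F y)) (x : M) : Prop :=
  MDifferentiableAt (𝓡 m) (𝓡 n).tangent (fun y => (⟨F y, V y⟩ : TangentBundle (𝓡 n) N)) x

variable (m) in
/-- The vector field `V` along `F` is smooth at `x`. -/
def SmoothAlongAt (F : M → N) (V : ∀ y : M, TangentSpace (𝓡 n) (F y)) (x : M) : Prop :=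
  ContMDiffAt (𝓡 m) (𝓡 n).tangent ∞ (fun y => (⟨F y, V y⟩ : TangentBundle (𝓡 n) N)) x

/-- The coordinates of `V`, a vector field along `F`, in the chart at `F x`. -/
def coordAlong (F : M → N) (V : ∀ y : M, TangentSpace (𝓡 n) (F y)) (x y : M) :
    EuclideanSpace ℝ (Fin n) :=
  (trivializationAt (EuclideanSpace ℝ (Fin n)) (TangentSpace (𝓡 n) : N → Type _) (F x)
    (⟨F y, V y⟩ : TangentBundle (𝓡 n) N)).2

variable {F : M → N} {V W : ∀ y : M, TangentSpace (𝓡 n) (F y)} {x : M}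

lemma smoothAlongAt_iff :
    SmoothAlongAt m F V x ↔ ContMDiffAt (𝓡 m) (𝓡 n) ∞ F x ∧
      ContMDiffAt (𝓡 m) 𝓘(ℝ, EuclideanSpace ℝ (Fin n)) ∞ (coordAlong F V x) x :=
  contMDiffAt_totalSpace

lemma diffAlongAt_iff :
    DiffAlongAt m F V x ↔ MDifferentiableAt (𝓡 m) (𝓡 n) F x ∧
      MDifferentiableAt (𝓡 m) 𝓘(ℝ, EuclideanSpace ℝ (Fin n)) (coordAlong F V x) x :=
  mdifferentiableAt_totalSpace (F := EuclideanSpace ℝ (Fin n)) (E := (TangentSpace (𝓡 n) : N → Type _))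
    (IB := 𝓡 n) (IM := 𝓡 m) _

lemma SmoothAlongAt.diffAlongAt (h : SmoothAlongAt m F V x) : DiffAlongAt m F V x :=
  ContMDiffAt.mdifferentiableAt h (by simp)

/-- Being `C^∞` at a point means being `C^k` near it for each finite `k`, on neighbourhoods that may
shrink with `k`. Only finite regularity passes to nearby points; `C¹` is enough here. -/
lemma SmoothAlongAt.eventually_diffAlongAt (h : SmoothAlongAt m F V x) :
    ∀ᶠ y in 𝓝 x, DiffAlongAt m F V y := by
  have h1 : ContMDiffAt (𝓡 m) (𝓡 n).tangent 1
      (fun y => (⟨F y, V y⟩ : TangentBundle (𝓡 n) N)) x := ContMDiffAt.of_le h (by simp)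
  filter_upwards [(contMDiffAt_iff_contMDiffAt_nhds (by simp)).1 h1] with y hy
  exact hy.mdifferentiableAt (by simp)

/-- The coordinates of a vector at `y`, in the chart at `q`. -/
def coordAt (q y : N) : TangentSpace (𝓡 n) y →L[ℝ] EuclideanSpace ℝ (Fin n) :=
  (trivializationAt (EuclideanSpace ℝ (Fin n)) (TangentSpace (𝓡 n) : N → Type _)
    q).continuousLinearMapAt ℝ y

variable (n) in
lemma mem_baseSet_nhds (q : N) :
    (trivializationAt (EuclideanSpace ℝ (Fin n)) (TangentSpace (𝓡 n) : N → Type _) q).baseSet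
      ∈ 𝓝 q :=
  (trivializationAt (EuclideanSpace ℝ (Fin n)) (TangentSpace (𝓡 n) : N → Type _)
    q).open_baseSet.mem_nhds (FiberBundle.mem_baseSet_trivializationAt' q)

/-- On the base set of the trivialization the coordinates depend linearly on the vector; sums and
multiples of fields are treated through this. -/
lemma coordAlong_eq {y : M} (hy : F y ∈ (trivializationAt (EuclideanSpace ℝ (Fin n))
    (TangentSpace (𝓡 n) : N → Type _) (F x)).baseSet) :
    coordAlong F V x y = coordAt (F x) (F y) (V y) := by
  rw [coordAt, Trivialization.continuousLinearMapAt_apply, Trivialization.linearMapAt_apply,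
    if_pos hy]
  rfl

lemma SmoothAlongAt.add (hV : SmoothAlongAt m F V x) (hW : SmoothAlongAt m F W x) :
    SmoothAlongAt m F (fun y => V y + W y) x := by
  rw [smoothAlongAt_iff] at *
  refine ⟨hV.1, (hV.2.add hW.2).congr_of_eventuallyEq ?_⟩
  filter_upwards [hV.1.continuousAt (mem_baseSet_nhds n (F x))] with y hy
  simp [coordAlong_eq hy]

lemma SmoothAlongAt.smul {f : M → ℝ} (hf : ContMDiffAt (𝓡 m) 𝓘(ℝ, ℝ) ∞ f x)
    (hV : SmoothAlongAt m F V x) : SmoothAlongAt m F (fun y => f y • V y) x := by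
  rw [smoothAlongAt_iff] at *
  refine ⟨hV.1, (hf.smul hV.2).congr_of_eventuallyEq ?_⟩
  filter_upwards [hV.1.continuousAt (mem_baseSet_nhds n (F x))] with y hy
  simp [coordAlong_eq hy]

lemma smoothAlongAt_zero (hF : ContMDiffAt (𝓡 m) (𝓡 n) ∞ F x) :
    SmoothAlongAt m F (fun y => (0 : TangentSpace (𝓡 n) (F y))) x := by
  rw [smoothAlongAt_iff]
  refine ⟨hF, (contMDiffAt_const (c := 0)).congr_of_eventuallyEq ?_⟩
  filter_upwards [hF.continuousAt (mem_baseSet_nhds n (F x))] with y hy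
  simp [coordAlong_eq hy]

lemma SmoothAlongAt.neg (hV : SmoothAlongAt m F V x) : SmoothAlongAt m F (fun y => -V y) x := by
  simpa using SmoothAlongAt.smul (f := fun _ => -1) contMDiffAt_const hV

lemma SmoothAlongAt.sub (hV : SmoothAlongAt m F V x) (hW : SmoothAlongAt m F W x) :
    SmoothAlongAt m F (fun y => V y - W y) x := by
  simpa [sub_eq_add_neg] using hV.add hW.neg

lemma SmoothAlongAt.sum {ι : Type*} {V : ι → ∀ y : M, TangentSpace (𝓡 n) (F y)} (s : Finset ι)
    (hF : ContMDiffAt (𝓡 m) (𝓡 n) ∞ F x) (hV : ∀ i ∈ s, SmoothAlongAt m F (V i) x) :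
    SmoothAlongAt m F (fun y => ∑ i ∈ s, V i y) x := by
  classical
  induction s using Finset.induction_on with
  | empty => simpa using smoothAlongAt_zero hF
  | insert a s ha ih =>
    simp only [Finset.sum_insert ha]
    exact (hV a (by simp)).add (ih fun i hi => hV i (by simp [hi]))

lemma SmoothAlongAt.congr (hV : SmoothAlongAt m F V x) (h : ∀ᶠ y in 𝓝 x, W y = V y) :
    SmoothAlongAt m F W x := by
  refine ContMDiffAt.congr_of_eventuallyEq hV ?_
  filter_upwards [h] with y hy
  rw [hy]

lemma DiffAlongAt.add (hV : DiffAlongAt m F V x) (hW : DiffAlongAt m F W x) :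
    DiffAlongAt m F (fun y => V y + W y) x := by
  rw [diffAlongAt_iff] at *
  refine ⟨hV.1, (hV.2.add hW.2).congr_of_eventuallyEq ?_⟩
  filter_upwards [hV.1.continuousAt (mem_baseSet_nhds n (F x))] with y hy
  simp [coordAlong_eq hy]

lemma DiffAlongAt.smul {f : M → ℝ} (hf : MDifferentiableAt (𝓡 m) 𝓘(ℝ, ℝ) f x)
    (hV : DiffAlongAt m F V x) : DiffAlongAt m F (fun y => f y • V y) x := by
  rw [diffAlongAt_iff] at *
  refine ⟨hV.1, (hf.smul hV.2).congr_of_eventuallyEq ?_⟩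
  filter_upwards [hV.1.continuousAt (mem_baseSet_nhds n (F x))] with y hy
  simp [coordAlong_eq hy]

lemma diffAlongAt_zero (hF : MDifferentiableAt (𝓡 m) (𝓡 n) F x) :
    DiffAlongAt m F (fun y => (0 : TangentSpace (𝓡 n) (F y))) x := by
  rw [diffAlongAt_iff]
  refine ⟨hF, (mdifferentiableAt_const (c := 0)).congr_of_eventuallyEq ?_⟩
  filter_upwards [hF.continuousAt (mem_baseSet_nhds n (F x))] with y hy
  simp [coordAlong_eq hy]

lemma DiffAlongAt.sum {ι : Type*} {V : ι → ∀ y : M, TangentSpace (𝓡 n) (F y)} (s : Finset ι)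
    (hF : MDifferentiableAt (𝓡 m) (𝓡 n) F x) (hV : ∀ i ∈ s, DiffAlongAt m F (V i) x) :
    DiffAlongAt m F (fun y => ∑ i ∈ s, V i y) x := by
  classical
  induction s using Finset.induction_on with
  | empty => simpa using diffAlongAt_zero hF
  | insert a s ha ih =>
    simp only [Finset.sum_insert ha]
    exact (hV a (by simp)).add (ih fun i hi => hV i (by simp [hi]))

/-- Composition of a vector field on `N` with `F`. -/
lemma SmoothAlongAt.comp {Z : ∀ y : N, TangentSpace (𝓡 n) y} (hZ : SmoothFieldAt Z (F x))
    (hF : ContMDiffAt (𝓡 m) (𝓡 n) ∞ F x) : SmoothAlongAt m F (fun y => Z (F y)) x :=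
  ContMDiffAt.comp (I' := 𝓡 n) x hZ hF

lemma DiffAlongAt.comp {Z : ∀ y : N, TangentSpace (𝓡 n) y}
    (hZ : DiffAlongAt n (fun y : N => y) Z (F x))
    (hF : MDifferentiableAt (𝓡 m) (𝓡 n) F x) : DiffAlongAt m F (fun y => Z (F y)) x :=
  MDifferentiableAt.comp (I' := 𝓡 n) x hZ hF

lemma SmoothAlongAt.mfderiv {X : ∀ y : M, TangentSpace (𝓡 m) y}
    (hX : SmoothFieldAt X x) (hF : ContMDiff (𝓡 m) (𝓡 n) ∞ F) :
    SmoothAlongAt m F (fun y => mfderiv (𝓡 m) (𝓡 n) F y (X y)) x := by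
  have := (hF.contMDiff_tangentMap (m := ∞) (by simp)).contMDiffAt
    (x := (⟨x, X x⟩ : TangentBundle (𝓡 m) M))
  exact ContMDiffAt.comp (I' := (𝓡 m).tangent) x this hX

variable [RiemannianBundle (fun y : N => TangentSpace (𝓡 n) y)]
  [IsContMDiffRiemannianBundle (𝓡 n) ∞ (EuclideanSpace ℝ (Fin n))
      (fun y : N => TangentSpace (𝓡 n) y)]

lemma SmoothAlongAt.inner (hV : SmoothAlongAt m F V x) (hW : SmoothAlongAt m F W x) :
    ContMDiffAt (𝓡 m) 𝓘(ℝ, ℝ) ∞ (fun y => (inner ℝ (V y) (W y) : ℝ)) x :=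
  ContMDiffAt.inner_bundle (IB := 𝓡 n) (F := EuclideanSpace ℝ (Fin n))
    (E := fun y : N => TangentSpace (𝓡 n) y) hV hW

lemma DiffAlongAt.inner (hV : DiffAlongAt m F V x) (hW : DiffAlongAt m F W x) :
    MDifferentiableAt (𝓡 m) 𝓘(ℝ, ℝ) (fun y => (inner ℝ (V y) (W y) : ℝ)) x := by
  have : IsContMDiffRiemannianBundle (𝓡 n) 1 (EuclideanSpace ℝ (Fin n))
      (fun y : N => TangentSpace (𝓡 n) y) := IsContMDiffRiemannianBundle.of_le (n := ∞) (by simp)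
  exact MDifferentiableAt.inner_bundle (IB := 𝓡 n) (F := EuclideanSpace ℝ (Fin n))
    (E := fun y : N => TangentSpace (𝓡 n) y) hV hW

end Along

/-! ### The connection in coordinates: algebraic rules. -/

section Connection

variable {n : ℕ} {N : Type*} [TopologicalSpace N]
  [ChartedSpace (EuclideanSpace ℝ (Fin n)) N] [IsManifold (𝓡 n) ∞ N]
  {m : ℕ} {M : Type*} [TopologicalSpace M]
  [ChartedSpace (EuclideanSpace ℝ (Fin m)) M] [IsManifold (𝓡 m) ∞ M]

lemma mvfderiv_congr {E' : Type*} [NormedAddCommGroup E'] [NormedSpace ℝ E'] {f g : M → E'} {x : M}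
    (h : f =ᶠ[𝓝 x] g) (v : TangentSpace (𝓡 m) x) :
    mvfderiv (𝓡 m) f x v = mvfderiv (𝓡 m) g x v := by
  rw [mvfderiv, mvfderiv, h.mfderiv_eq]
  rfl

lemma coordAt_symm (q y : N) (hy : y ∈ (trivializationAt (EuclideanSpace ℝ (Fin n))
    (TangentSpace (𝓡 n) : N → Type _) q).baseSet) (a : EuclideanSpace ℝ (Fin n)) :
    coordAt q y ((trivializationAt (EuclideanSpace ℝ (Fin n))
      (TangentSpace (𝓡 n) : N → Type _) q).symmL ℝ y a) = a :=
  Trivialization.continuousLinearMapAt_symmL _ hy a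

lemma symm_coordAt (q y : N) (hy : y ∈ (trivializationAt (EuclideanSpace ℝ (Fin n))
    (TangentSpace (𝓡 n) : N → Type _) q).baseSet) (u : TangentSpace (𝓡 n) y) :
    (trivializationAt (EuclideanSpace ℝ (Fin n))
      (TangentSpace (𝓡 n) : N → Type _) q).symmL ℝ y (coordAt q y u) = u :=
  Trivialization.symmL_continuousLinearMapAt _ hy u

lemma coordField_eq (q : N) (u : TangentSpace (𝓡 n) q) {y : N}
    (hy : y ∈ (trivializationAt (EuclideanSpace ℝ (Fin n))
      (TangentSpace (𝓡 n) : N → Type _) q).baseSet) :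
    coordField q u y = (trivializationAt (EuclideanSpace ℝ (Fin n))
      (TangentSpace (𝓡 n) : N → Type _) q).symmL ℝ y (coordAt q q u) := by
  rw [coordField, FiberBundle.extend, coordAt, Trivialization.continuousLinearMapAt_apply,
    Trivialization.linearMapAt_apply, if_pos (FiberBundle.mem_baseSet_trivializationAt' q),
    Trivialization.symmL_apply _ hy]

lemma coordField_self (q : N) (u : TangentSpace (𝓡 n) q) : coordField q u q = u :=
  FiberBundle.extend_apply_self _ _

lemma coordField_add (q : N) (u w : TangentSpace (𝓡 n) q) :
    ∀ᶠ y in 𝓝 q, coordField q (u + w) y = coordField q u y + coordField q w y := by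
  filter_upwards [mem_baseSet_nhds n q] with y hy
  simp [coordField_eq _ _ hy]

lemma coordField_smul (q : N) (r : ℝ) (u : TangentSpace (𝓡 n) q) :
    ∀ᶠ y in 𝓝 q, coordField q (r • u) y = r • coordField q u y := by
  filter_upwards [mem_baseSet_nhds n q] with y hy
  simp [coordField_eq _ _ hy]

lemma smoothFieldAt_coordField (q : N) (u : TangentSpace (𝓡 n) q) :
    SmoothFieldAt (coordField q u) q :=
  FiberBundle.contMDiffAt_extend (𝓡 n) (EuclideanSpace ℝ (Fin n)) u

lemma diffAlongAt_coordField (q : N) (u : TangentSpace (𝓡 n) q) :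
    DiffAlongAt n (fun y : N => y) (coordField q u) q :=
  SmoothAlongAt.diffAlongAt (F := fun y : N => y) (smoothFieldAt_coordField q u)

variable [RiemannianBundle (fun y : N => TangentSpace (𝓡 n) y)]
  [IsContMDiffRiemannianBundle (𝓡 n) ∞ (EuclideanSpace ℝ (Fin n))
      (fun y : N => TangentSpace (𝓡 n) y)]

/-! ### Christoffel symbols -/

lemma metricDeriv_add_left (q : N) (w w' u v : TangentSpace (𝓡 n) q) :
    metricDeriv q (w + w') u v = metricDeriv q w u v + metricDeriv q w' u v :=
  map_add _ _ _

lemma metricDeriv_smul_left (q : N) (r : ℝ) (w u v : TangentSpace (𝓡 n) q) :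
    metricDeriv q (r • w) u v = r * metricDeriv q w u v :=
  map_smul (mvfderiv (𝓡 n) (fun y : N => (inner ℝ (coordField q u y) (coordField q v y) : ℝ)) q) _ _

lemma metricDeriv_symm (q : N) (w u v : TangentSpace (𝓡 n) q) :
    metricDeriv q w u v = metricDeriv q w v u := by
  simp only [metricDeriv]
  congr 2
  ext y
  exact real_inner_comm _ _

lemma metricDeriv_add_middle (q : N) (w u u' v : TangentSpace (𝓡 n) q) :
    metricDeriv q w (u + u') v = metricDeriv q w u v + metricDeriv q w u' v := by
  simp only [metricDeriv]
  rw [mvfderiv_congr (g := fun y => (inner ℝ (coordField q u y) (coordField q v y) : ℝ)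
    + (inner ℝ (coordField q u' y) (coordField q v y) : ℝ))]
  swap
  · filter_upwards [coordField_add q u u'] with y hy
    rw [hy, inner_add_left]
  rw [mvfderiv_fun_add ((diffAlongAt_coordField q u).inner (diffAlongAt_coordField q v))
    ((diffAlongAt_coordField q u').inner (diffAlongAt_coordField q v))]
  rfl

lemma metricDeriv_smul_middle (q : N) (r : ℝ) (w u v : TangentSpace (𝓡 n) q) :
    metricDeriv q w (r • u) v = r * metricDeriv q w u v := by
  simp only [metricDeriv]
  rw [mvfderiv_congr (g := fun y => r * (inner ℝ (coordField q u y) (coordField q v y) : ℝ))]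
  swap
  · filter_upwards [coordField_smul q r u] with y hy
    rw [hy, real_inner_smul_left]
  rw [mvfderiv_fun_mul mdifferentiableAt_const
    ((diffAlongAt_coordField q u).inner (diffAlongAt_coordField q v)), mvfderiv_const]
  simp

lemma metricDeriv_add_right (q : N) (w u v v' : TangentSpace (𝓡 n) q) :
    metricDeriv q w u (v + v') = metricDeriv q w u v + metricDeriv q w u v' := by
  rw [metricDeriv_symm, metricDeriv_add_middle, metricDeriv_symm q w v, metricDeriv_symm q w v']

lemma metricDeriv_smul_right (q : N) (r : ℝ) (w u v : TangentSpace (𝓡 n) q) :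
    metricDeriv q w u (r • v) = r * metricDeriv q w u v := by
  rw [metricDeriv_symm, metricDeriv_smul_middle, metricDeriv_symm]

lemma inner_christoffel (q : N) (u v w : TangentSpace (𝓡 n) q) :
    (inner ℝ (christoffel q u v) w : ℝ)
      = (metricDeriv q u v w + metricDeriv q v u w - metricDeriv q w u v) / 2 := by
  -- The right-hand side is linear in `w`, so it is determined by its values on `frame q`, which are
  -- the coefficients in the definition.
  let L : TangentSpace (𝓡 n) q →ₗ[ℝ] ℝ :=
    { toFun := fun w => (metricDeriv q u v w + metricDeriv q v u w - metricDeriv q w u v) / 2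
      map_add' := fun a b => by
        simp only [metricDeriv_add_right, metricDeriv_add_left]; ring
      map_smul' := fun r a => by
        simp only [metricDeriv_smul_right, metricDeriv_smul_left, RingHom.id_apply, smul_eq_mul]
        ring }
  change _ = L w
  conv_rhs => rw [← (frame q).sum_repr' w, map_sum]
  rw [christoffel, sum_inner]
  refine Finset.sum_congr rfl fun k _ => ?_
  rw [inner_smul_left, map_smul, smul_eq_mul, mul_comm]
  rfl

lemma christoffel_symm (q : N) (u v : TangentSpace (𝓡 n) q) :
    christoffel q u v = christoffel q v u := by
  refine ext_inner_right ℝ fun w => ?_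
  rw [inner_christoffel, inner_christoffel, metricDeriv_symm q w u v]
  ring

lemma christoffel_add_left (q : N) (u u' v : TangentSpace (𝓡 n) q) :
    christoffel q (u + u') v = christoffel q u v + christoffel q u' v := by
  refine ext_inner_right ℝ fun w => ?_
  simp only [inner_add_left, inner_christoffel, metricDeriv_add_left, metricDeriv_add_middle]
  ring

lemma christoffel_smul_left (q : N) (r : ℝ) (u v : TangentSpace (𝓡 n) q) :
    christoffel q (r • u) v = r • christoffel q u v := by
  refine ext_inner_right ℝ fun w => ?_
  simp only [inner_smul_left, inner_christoffel, metricDeriv_smul_left, metricDeriv_smul_middle,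
    conj_trivial]
  ring

lemma christoffel_add_right (q : N) (u v v' : TangentSpace (𝓡 n) q) :
    christoffel q u (v + v') = christoffel q u v + christoffel q u v' := by
  rw [christoffel_symm, christoffel_add_left, christoffel_symm q v, christoffel_symm q v']

lemma christoffel_smul_right (q : N) (r : ℝ) (u v : TangentSpace (𝓡 n) q) :
    christoffel q u (r • v) = r • christoffel q u v := by
  rw [christoffel_symm, christoffel_smul_left, christoffel_symm]

/-- Metric compatibility at the level of Christoffel symbols: of the six derivative terms on the
right, four cancel and two add up. -/
lemma metricDeriv_eq (q : N) (w u v : TangentSpace (𝓡 n) q) :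
    metricDeriv q w u v
      = (inner ℝ (christoffel q w u) v : ℝ) + (inner ℝ u (christoffel q w v) : ℝ) := by
  rw [real_inner_comm (christoffel q w v), inner_christoffel, inner_christoffel, metricDeriv_symm q w v u,
    metricDeriv_symm q v w u, metricDeriv_symm q u w v]
  ring

/-! ### The covariant derivative along a map -/

variable {F : M → N} {V W : ∀ y : M, TangentSpace (𝓡 n) (F y)} {x : M}

lemma covAlong_def (V : ∀ y : M, TangentSpace (𝓡 n) (F y)) (v : TangentSpace (𝓡 m) x) :
    covAlong F V x v = (trivializationAt (EuclideanSpace ℝ (Fin n))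
      (TangentSpace (𝓡 n) : N → Type _) (F x)).symmL ℝ (F x)
        (mvfderiv (𝓡 m) (coordAlong F V x) x v)
      + christoffel (F x) (mfderiv (𝓡 m) (𝓡 n) F x v) (V x) := by
  rw [Trivialization.symmL_apply _ (FiberBundle.mem_baseSet_trivializationAt' (F x))]
  rfl

lemma covAlong_add_dir (V : ∀ y : M, TangentSpace (𝓡 n) (F y)) (v w : TangentSpace (𝓡 m) x) :
    covAlong F V x (v + w) = covAlong F V x v + covAlong F V x w := by
  simp only [covAlong_def, map_add, christoffel_add_left]
  abel

lemma covAlong_smul_dir (V : ∀ y : M, TangentSpace (𝓡 n) (F y)) (r : ℝ)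
    (v : TangentSpace (𝓡 m) x) : covAlong F V x (r • v) = r • covAlong F V x v := by
  simp only [covAlong_def, map_smul, christoffel_smul_left, smul_add]

/-- The covariant derivative as a linear map of the direction. -/
def covAlongL (F : M → N) (V : ∀ y : M, TangentSpace (𝓡 n) (F y)) (x : M) :
    TangentSpace (𝓡 m) x →ₗ[ℝ] TangentSpace (𝓡 n) (F x) where
  toFun := covAlong F V x
  map_add' := covAlong_add_dir V
  map_smul' := covAlong_smul_dir V

lemma covAlong_sum_dir (V : ∀ y : M, TangentSpace (𝓡 n) (F y)) {ι : Type*} (s : Finset ι)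
    (v : ι → TangentSpace (𝓡 m) x) : covAlong F V x (∑ i ∈ s, v i) = ∑ i ∈ s, covAlong F V x (v i) :=
  map_sum (covAlongL F V x) v s

lemma covAlong_congr (h : ∀ᶠ y in 𝓝 x, V y = W y) (v : TangentSpace (𝓡 m) x) :
    covAlong F V x v = covAlong F W x v := by
  have h1 : coordAlong F V x =ᶠ[𝓝 x] coordAlong F W x := by
    filter_upwards [h] with y hy
    rw [coordAlong, coordAlong, hy]
  rw [covAlong_def, covAlong_def, h.self_of_nhds, mvfderiv, mvfderiv, h1.mfderiv_eq]
  rfl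

lemma covAlong_add (hV : DiffAlongAt m F V x) (hW : DiffAlongAt m F W x)
    (v : TangentSpace (𝓡 m) x) :
    covAlong F (fun y => V y + W y) x v = covAlong F V x v + covAlong F W x v := by
  have hF := (diffAlongAt_iff.1 hV).1
  have h : coordAlong F (fun y => V y + W y) x =ᶠ[𝓝 x]
      fun y => coordAlong F V x y + coordAlong F W x y := by
    filter_upwards [hF.continuousAt (mem_baseSet_nhds n (F x))] with y hy
    simp [coordAlong_eq hy]
  simp only [covAlong_def, christoffel_add_right]
  rw [mvfderiv_congr h, mvfderiv_fun_add (diffAlongAt_iff.1 hV).2 (diffAlongAt_iff.1 hW).2,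
    add_apply, map_add]
  abel

lemma covAlong_smul {f : M → ℝ} (hf : MDifferentiableAt (𝓡 m) 𝓘(ℝ, ℝ) f x)
    (hV : DiffAlongAt m F V x) (v : TangentSpace (𝓡 m) x) :
    covAlong F (fun y => f y • V y) x v
      = mvfderiv (𝓡 m) f x v • V x + f x • covAlong F V x v := by
  have hF := (diffAlongAt_iff.1 hV).1
  have h : coordAlong F (fun y => f y • V y) x =ᶠ[𝓝 x] fun y => f y • coordAlong F V x y := by
    filter_upwards [hF.continuousAt (mem_baseSet_nhds n (F x))] with y hy
    simp [coordAlong_eq hy]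
  have hx := (FiberBundle.mem_baseSet_trivializationAt' (F := EuclideanSpace ℝ (Fin n))
    (E := (TangentSpace (𝓡 n) : N → Type _)) (F x))
  simp only [covAlong_def, christoffel_smul_right]
  rw [mvfderiv_congr h, mvfderiv_fun_smul hf (diffAlongAt_iff.1 hV).2]
  simp only [add_apply, smul_apply, ContinuousLinearMap.smulRight_apply, map_add, map_smul, smul_add]
  rw [coordAlong_eq hx, symm_coordAt _ _ hx]
  abel

end Connection

/-! ### Chain rule and compatibility with the metric. -/

section Compatibility

variable {n : ℕ} {N : Type*} [TopologicalSpace N]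
  [ChartedSpace (EuclideanSpace ℝ (Fin n)) N] [IsManifold (𝓡 n) ∞ N]
  {m : ℕ} {M : Type*} [TopologicalSpace M]
  [ChartedSpace (EuclideanSpace ℝ (Fin m)) M] [IsManifold (𝓡 m) ∞ M]

variable {F : M → N} {V W : ∀ y : M, TangentSpace (𝓡 n) (F y)} {x : M}

lemma mvfderiv_comp_vec {E' : Type*} [NormedAddCommGroup E'] [NormedSpace ℝ E'] {g : N → E'}
    (hg : MDifferentiableAt (𝓡 n) 𝓘(ℝ, E') g (F x)) (hF : MDifferentiableAt (𝓡 m) (𝓡 n) F x)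
    (v : TangentSpace (𝓡 m) x) :
    mvfderiv (𝓡 m) (fun y => g (F y)) x v
      = mvfderiv (𝓡 n) g (F x) (mfderiv (𝓡 m) (𝓡 n) F x v) :=
  mfderiv_comp_apply (I' := 𝓡 n) (I'' := 𝓘(ℝ, E')) x hg hF v

lemma mfderiv_id_apply (q : N) (v : TangentSpace (𝓡 n) q) :
    mfderiv (𝓡 n) (𝓡 n) (fun y : N => y) q v = v := by
  have : mfderiv (𝓡 n) (𝓡 n) (fun y : N => y) q = ContinuousLinearMap.id ℝ _ := mfderiv_id
  rw [this]; rfl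

lemma mdifferentiableAt_coord (q : N) (Z : ∀ y : N, TangentSpace (𝓡 n) y)
    (hZ : DiffAlongAt n (fun y : N => y) Z q) :
    MDifferentiableAt (𝓡 n) 𝓘(ℝ, EuclideanSpace ℝ (Fin n)) (coordAlong (fun y : N => y) Z q) q :=
  (diffAlongAt_iff.1 hZ).2

variable [RiemannianBundle (fun y : N => TangentSpace (𝓡 n) y)]
  [IsContMDiffRiemannianBundle (𝓡 n) ∞ (EuclideanSpace ℝ (Fin n))
      (fun y : N => TangentSpace (𝓡 n) y)]

/-- The chain rule `∇^F_v (Z ∘ F) = ∇_{dF v} Z`. -/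
lemma covAlong_comp {Z : ∀ y : N, TangentSpace (𝓡 n) y}
    (hZ : DiffAlongAt n (fun y : N => y) Z (F x)) (hF : MDifferentiableAt (𝓡 m) (𝓡 n) F x)
    (v : TangentSpace (𝓡 m) x) :
    covAlong F (fun y => Z (F y)) x v = leviCivita Z (F x) (mfderiv (𝓡 m) (𝓡 n) F x v) := by
  rw [leviCivita, covAlong_def, covAlong_def, mfderiv_id_apply,
    ← mvfderiv_comp_vec (mdifferentiableAt_coord (F x) Z hZ) hF v]
  rfl

/-- The coordinates of the field are constant near `q`, so only the Christoffel term survives. -/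
lemma leviCivita_coordField (q : N) (u v : TangentSpace (𝓡 n) q) :
    leviCivita (coordField q u) q v = christoffel q v u := by
  have h : coordAlong (fun y : N => y) (coordField q u) q =ᶠ[𝓝 q] fun _ => coordAt q q u := by
    filter_upwards [mem_baseSet_nhds n q] with y hy
    rw [coordAlong_eq (F := fun y : N => y) (x := q) hy, coordField_eq q u hy,
      coordAt_symm q y hy]
  rw [leviCivita, covAlong_def, mvfderiv_congr h, mvfderiv_const, mfderiv_id_apply,
    coordField_self]
  simp

/-- A vector field along `F` is a combination of coordinate fields of the target. -/
lemma eventually_eq_sum_coordField (hF : ContinuousAt F x)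
    (V : ∀ y : M, TangentSpace (𝓡 n) (F y)) :
    ∀ᶠ y in 𝓝 x, V y = ∑ k, coordAlong F V x y k • coordField (F x)
      ((trivializationAt (EuclideanSpace ℝ (Fin n)) (TangentSpace (𝓡 n) : N → Type _)
        (F x)).symmL ℝ (F x) (EuclideanSpace.single k 1)) (F y) := by
  filter_upwards [hF (mem_baseSet_nhds n (F x))] with y hy
  have hx := (FiberBundle.mem_baseSet_trivializationAt' (F := EuclideanSpace ℝ (Fin n))
    (E := (TangentSpace (𝓡 n) : N → Type _)) (F x))
  simp only [coordField_eq _ _ hy, coordAt_symm _ _ hx]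
  simp only [← map_smul, ← map_sum]
  have : ∑ k, coordAlong F V x y k • (EuclideanSpace.single k (1 : ℝ)) = coordAlong F V x y := by
    ext j
    simp [Finset.sum_apply, Pi.single_apply]
  rw [this, coordAlong_eq hy, symm_coordAt _ _ hy]

/-- A property of vector fields along `F` holds in general if it holds for coordinate fields
of the target, is local and compatible with sums and products with functions. -/
theorem DiffAlongAt.induction {P : (∀ y : M, TangentSpace (𝓡 n) (F y)) → Prop}
    (hV : DiffAlongAt m F V x)
    (hcoord : ∀ u, P fun y => coordField (F x) u (F y))
    (hadd : ∀ V W, DiffAlongAt m F V x → DiffAlongAt m F W x → P V → P W → P fun y => V y + W y)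
    (hsmul : ∀ (f : M → ℝ) V, MDifferentiableAt (𝓡 m) 𝓘(ℝ, ℝ) f x → DiffAlongAt m F V x → P V →
      P fun y => f y • V y)
    (hcongr : ∀ V W, DiffAlongAt m F V x → P V → (∀ᶠ y in 𝓝 x, W y = V y) → P W) : P V := by
  classical
  obtain ⟨hF, hc⟩ := diffAlongAt_iff.1 hV
  set b := fun k : Fin n => (trivializationAt (EuclideanSpace ℝ (Fin n))
    (TangentSpace (𝓡 n) : N → Type _) (F x)).symmL ℝ (F x) (EuclideanSpace.single k 1)
  have hk (k : Fin n) : MDifferentiableAt (𝓡 m) 𝓘(ℝ, ℝ) (fun y => coordAlong F V x y k) x :=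
    ((EuclideanSpace.proj (𝕜 := ℝ) k).contMDiff (n := 1)).mdifferentiable one_ne_zero _ |>.comp x hc
  have hd (u) : DiffAlongAt m F (fun y => coordField (F x) u (F y)) x :=
    DiffAlongAt.comp (diffAlongAt_coordField (F x) u) hF
  have hz : DiffAlongAt m F (fun y => (0 : TangentSpace (𝓡 n) (F y))) x := diffAlongAt_zero hF
  have hs (s : Finset (Fin n)) :
      P fun y => ∑ k ∈ s, coordAlong F V x y k • coordField (F x) (b k) (F y) := by
    induction s using Finset.induction_on with
    | empty =>
      have h0 := hsmul (fun _ => 0) _ mdifferentiableAt_const (hd 0) (hcoord 0)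
      simpa using h0
    | insert a s ha ih =>
      simp only [Finset.sum_insert ha]
      exact hadd _ _ ((hd _).smul (hk a)) (DiffAlongAt.sum s hF fun i _ => (hd _).smul (hk i))
        (hsmul _ _ (hk a) (hd _) (hcoord _)) ih
  exact hcongr _ _ (DiffAlongAt.sum Finset.univ hF fun i _ => (hd (b i)).smul (hk i))
    (hs Finset.univ) (eventually_eq_sum_coordField hF.continuousAt V)

/-- The connection is compatible with the metric. -/
theorem mvfderiv_inner (hV : DiffAlongAt m F V x) (hW : DiffAlongAt m F W x)
    (v : TangentSpace (𝓡 m) x) :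
    mvfderiv (𝓡 m) (fun y => (inner ℝ (V y) (W y) : ℝ)) x v
      = (inner ℝ (covAlong F V x v) (W x) : ℝ) + (inner ℝ (V x) (covAlong F W x v) : ℝ) := by
  obtain ⟨hF, -⟩ := diffAlongAt_iff.1 hV
  have hd (u) : DiffAlongAt m F (fun y => coordField (F x) u (F y)) x :=
    DiffAlongAt.comp (diffAlongAt_coordField (F x) u) hF
  -- Both sides obey the same Leibniz rules in `V` and in `W`. An induction on `V`, with one on `W`
  -- inside its base case, leaves coordinate fields of the target.
  refine DiffAlongAt.induction (P := fun V => mvfderiv (𝓡 m) (fun y => (inner ℝ (V y) (W y) : ℝ)) x v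
      = (inner ℝ (covAlong F V x v) (W x) : ℝ) + (inner ℝ (V x) (covAlong F W x v) : ℝ)) hV
      (fun u => ?_) (fun V V' hV hV' h h' => ?_) (fun f V hf hV h => ?_) (fun V V' hV h h' => ?_)
  · refine DiffAlongAt.induction (P := fun W => mvfderiv (𝓡 m)
      (fun y => (inner ℝ (coordField (F x) u (F y)) (W y) : ℝ)) x v
      = (inner ℝ (covAlong F (fun y => coordField (F x) u (F y)) x v) (W x) : ℝ)
        + (inner ℝ (coordField (F x) u (F x)) (covAlong F W x v) : ℝ)) hW
      (fun w => ?_) (fun V V' hV hV' h h' => ?_) (fun f V hf hV h => ?_) (fun V V' hV h h' => ?_)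
    · change mvfderiv (𝓡 m)
        (fun y => (inner ℝ (coordField (F x) u (F y)) (coordField (F x) w (F y)) : ℝ)) x v
        = (inner ℝ (covAlong F (fun y => coordField (F x) u (F y)) x v) (coordField (F x) w (F x)) : ℝ)
        + (inner ℝ (coordField (F x) u (F x)) (covAlong F (fun y => coordField (F x) w (F y)) x v) : ℝ)
      -- For coordinate fields the claim is `metricDeriv_eq` in the direction `dF v`, combined with
      -- the chain rule.
      rw [covAlong_comp (diffAlongAt_coordField _ _) hF, covAlong_comp (diffAlongAt_coordField _ _) hF,
        leviCivita_coordField, leviCivita_coordField, coordField_self, coordField_self,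
        ← metricDeriv_eq, metricDeriv]
      exact mvfderiv_comp_vec (g := fun y => (inner ℝ (coordField (F x) u y) (coordField (F x) w y) : ℝ))
        ((diffAlongAt_coordField (F x) u).inner (diffAlongAt_coordField (F x) w)) hF v
    · simp only [inner_add_right]
      rw [mvfderiv_fun_add ((hd u).inner hV) ((hd u).inner hV'), covAlong_add hV hV',
        inner_add_right, add_apply, h, h']
      ring
    · simp only [inner_smul_right]
      rw [mvfderiv_fun_mul hf ((hd u).inner hV), covAlong_smul hf hV, inner_add_right,
        inner_smul_right, inner_smul_right, add_apply, smul_apply, smul_apply, h, smul_eq_mul,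
        smul_eq_mul]
      ring
    · rw [covAlong_congr h', h'.self_of_nhds, ← h]
      refine mvfderiv_congr ?_ v
      filter_upwards [h'] with y hy
      rw [hy]
  · simp only [inner_add_left]
    rw [mvfderiv_fun_add (hV.inner hW) (hV'.inner hW), covAlong_add hV hV', inner_add_left,
      add_apply, h, h']
    ring
  · simp only [real_inner_smul_left]
    rw [mvfderiv_fun_mul hf (hV.inner hW), covAlong_smul hf hV, inner_add_left,
      real_inner_smul_left, real_inner_smul_left, add_apply, smul_apply, smul_apply, h,
      smul_eq_mul, smul_eq_mul]
    ring
  · rw [covAlong_congr h', h'.self_of_nhds, ← h]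
    refine mvfderiv_congr ?_ v
    filter_upwards [h'] with y hy
    rw [hy]

end Compatibility

/-! ### Lie brackets in a chart and vanishing torsion. -/

section Torsion

variable {n : ℕ} {N : Type*} [TopologicalSpace N]
  [ChartedSpace (EuclideanSpace ℝ (Fin n)) N] [IsManifold (𝓡 n) ∞ N]
  {m : ℕ} {M : Type*} [TopologicalSpace M]
  [ChartedSpace (EuclideanSpace ℝ (Fin m)) M] [IsManifold (𝓡 m) ∞ M]

variable {F : M → N} {x : M}

open VectorField

lemma eventually_eq_inverse_mpullback (Y : ∀ y : M, TangentSpace (𝓡 m) y) (x : M) :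
    ∀ᶠ y in 𝓝 x, mfderiv (𝓡 m) 𝓘(ℝ, EuclideanSpace ℝ (Fin m)) (extChartAt (𝓡 m) x) y (Y y)
      = mpullbackWithin 𝓘(ℝ, EuclideanSpace ℝ (Fin m)) (𝓡 m) (extChartAt (𝓡 m) x).symm Y
        (range (𝓡 m)) (extChartAt (𝓡 m) x y) := by
  have h := eventuallyEq_mpullback_mpullbackWithin_extChartAt (I := 𝓡 m) (s := univ) (x := x) Y
  rw [nhdsWithin_univ] at h
  filter_upwards [h, extChartAt_source_mem_nhds (I := 𝓡 m) x] with y hy hys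
  conv_lhs => rw [hy, mpullback_apply]
  exact (isInvertible_mfderiv_extChartAt hys).self_apply_inverse _

/-- The local representative of a vector field in the chart at `x`. -/
def chartField (x : M) (Y : ∀ y : M, TangentSpace (𝓡 m) y) :
    EuclideanSpace ℝ (Fin m) → EuclideanSpace ℝ (Fin m) :=
  mpullbackWithin 𝓘(ℝ, EuclideanSpace ℝ (Fin m)) (𝓡 m) (extChartAt (𝓡 m) x).symm Y
        (range (𝓡 m))

lemma differentiableAt_chartField {Y : ∀ y : M, TangentSpace (𝓡 m) y}
    (hY : DiffAlongAt m (fun y : M => y) Y x) :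
    DifferentiableAt ℝ (chartField x Y) (extChartAt (𝓡 m) x x) := by
  have h := MDifferentiableWithinAt.differentiableWithinAt_mpullbackWithin_vectorField
    (I := 𝓡 m) (s := univ) (x := x) (V := Y) (mdifferentiableWithinAt_univ.2 hY)
  have hs : (extChartAt (𝓡 m) x).symm ⁻¹' univ ∩ range (𝓡 m) = univ := by simp
  rw [hs] at h
  exact differentiableWithinAt_univ.1 h

lemma mfderiv_extChartAt_mlieBracket (X Y : ∀ y : M, TangentSpace (𝓡 m) y) (x : M) :
    mfderiv (𝓡 m) 𝓘(ℝ, EuclideanSpace ℝ (Fin m)) (extChartAt (𝓡 m) x) x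
      (mlieBracket (𝓡 m) X Y x)
      = fderiv ℝ (chartField x Y) (extChartAt (𝓡 m) x x) (chartField x X (extChartAt (𝓡 m) x x))
        - fderiv ℝ (chartField x X) (extChartAt (𝓡 m) x x)
          (chartField x Y (extChartAt (𝓡 m) x x)) := by
  rw [← mlieBracketWithin_univ, mlieBracketWithin_apply]
  refine ((isInvertible_mfderiv_extChartAt
    (mem_extChartAt_source (I := 𝓡 m) x)).self_apply_inverse _).trans ?_
  have hs : (extChartAt (𝓡 m) x).symm ⁻¹' univ ∩ range (𝓡 m) = univ := by simp
  rw [hs]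
  change lieBracketWithin ℝ (chartField x X) (chartField x Y) univ _ = _
  rw [lieBracketWithin_univ, lieBracket]

lemma chartField_mlieBracket (X Y : ∀ y : M, TangentSpace (𝓡 m) y) (x : M) :
    chartField x (mlieBracket (𝓡 m) X Y) (extChartAt (𝓡 m) x x)
      = fderiv ℝ (chartField x Y) (extChartAt (𝓡 m) x x) (chartField x X (extChartAt (𝓡 m) x x))
        - fderiv ℝ (chartField x X) (extChartAt (𝓡 m) x x)
          (chartField x Y (extChartAt (𝓡 m) x x)) :=
  (eventually_eq_inverse_mpullback (mlieBracket (𝓡 m) X Y) x).self_of_nhds.symm.trans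
    (mfderiv_extChartAt_mlieBracket X Y x)

variable {E' : Type*} [NormedAddCommGroup E'] [NormedSpace ℝ E'] {G : M → E'}

lemma contDiffAt_comp_extChartAt_symm {k : ℕ∞} (hG : ContMDiffAt (𝓡 m) 𝓘(ℝ, E') k G x) :
    ContDiffAt ℝ k (G ∘ (extChartAt (𝓡 m) x).symm) (extChartAt (𝓡 m) x x) := by
  have h := (contMDiffAt_iff.1 hG).2
  rw [ModelWithCorners.range_eq_univ, contDiffWithinAt_univ] at h
  exact h

lemma eventually_mvfderiv_eq (hG : ContMDiffAt (𝓡 m) 𝓘(ℝ, E') 1 G x)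
    (Y : ∀ y : M, TangentSpace (𝓡 m) y) :
    ∀ᶠ y in 𝓝 x, mvfderiv (𝓡 m) G y (Y y)
      = fderiv ℝ (G ∘ (extChartAt (𝓡 m) x).symm) (extChartAt (𝓡 m) x y)
        (chartField x Y (extChartAt (𝓡 m) x y)) := by
  have hd : ∀ᶠ z in 𝓝 (extChartAt (𝓡 m) x x),
      DifferentiableAt ℝ (G ∘ (extChartAt (𝓡 m) x).symm) z := by
    have h : ContDiffAt ℝ 1 _ _ := contDiffAt_comp_extChartAt_symm (k := 1) hG
    filter_upwards [h.eventually (by simp)] with z hz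
    exact hz.differentiableAt (by simp)
  have hsrc := extChartAt_source_mem_nhds (I := 𝓡 m) x
  filter_upwards [eventually_eq_inverse_mpullback Y x, eventually_eventually_nhds.2 hsrc,
    (continuousAt_extChartAt (I := 𝓡 m) x).eventually hd] with y hy hys hdy
  have hG' : G =ᶠ[𝓝 y] fun y => (G ∘ (extChartAt (𝓡 m) x).symm) (extChartAt (𝓡 m) x y) := by
    filter_upwards [hys] with z hz
    simp only [Function.comp]
    rw [(extChartAt (𝓡 m) x).left_inv hz]
  have hch : MDifferentiableAt (𝓡 m) 𝓘(ℝ, EuclideanSpace ℝ (Fin m)) (extChartAt (𝓡 m) x) y :=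
    mdifferentiableAt_extChartAt (by rw [← extChartAt_source (𝓡 m)]; exact hys.self_of_nhds)
  rw [mvfderiv_congr hG',
    mvfderiv_comp_vec (n := m) (F := extChartAt (𝓡 m) x) hdy.mdifferentiableAt hch, hy]
  exact congrFun (congrArg DFunLike.coe (mfderiv_eq_fderiv (𝕜 := ℝ)
    (f := G ∘ (extChartAt (𝓡 m) x).symm) (x := extChartAt (𝓡 m) x y))) _

/-- The product rule in the chart separates a Hessian term, symmetric in the two directions, from a
first-order term whose antisymmetrization gives the Lie bracket. -/
lemma mvfderiv_mvfderiv (hG : ContMDiffAt (𝓡 m) 𝓘(ℝ, E') 2 G x)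
    {X Y : ∀ y : M, TangentSpace (𝓡 m) y} (hY : DiffAlongAt m (fun y : M => y) Y x) :
    mvfderiv (𝓡 m) (fun y => mvfderiv (𝓡 m) G y (Y y)) x (X x)
      = fderiv ℝ (fderiv ℝ (G ∘ (extChartAt (𝓡 m) x).symm)) (extChartAt (𝓡 m) x x)
          (chartField x X (extChartAt (𝓡 m) x x)) (chartField x Y (extChartAt (𝓡 m) x x))
        + fderiv ℝ (G ∘ (extChartAt (𝓡 m) x).symm) (extChartAt (𝓡 m) x x)
          (fderiv ℝ (chartField x Y) (extChartAt (𝓡 m) x x)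
            (chartField x X (extChartAt (𝓡 m) x x))) := by
  have h2 : ContDiffAt ℝ 2 _ _ := contDiffAt_comp_extChartAt_symm (k := 2) hG
  have hd : DifferentiableAt ℝ (fderiv ℝ (G ∘ (extChartAt (𝓡 m) x).symm))
      (extChartAt (𝓡 m) x x) :=
    (h2.fderiv_right (m := 1) (by norm_num)).differentiableAt (by simp)
  have hY' := differentiableAt_chartField hY
  have hch : MDifferentiableAt (𝓡 m) 𝓘(ℝ, EuclideanSpace ℝ (Fin m)) (extChartAt (𝓡 m) x) x :=
    mdifferentiableAt_extChartAt (by simp)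
  rw [mvfderiv_congr (eventually_mvfderiv_eq (hG.of_le (by norm_num)) Y),
    mvfderiv_comp_vec (n := m) (F := extChartAt (𝓡 m) x) (g := fun z =>
      fderiv ℝ (G ∘ (extChartAt (𝓡 m) x).symm) z (chartField x Y z))
      (hd.clm_apply hY').mdifferentiableAt hch,
    (eventually_eq_inverse_mpullback X x).self_of_nhds]
  refine (congrFun (congrArg DFunLike.coe (mfderiv_eq_fderiv (𝕜 := ℝ) (f := fun z =>
    fderiv ℝ (G ∘ (extChartAt (𝓡 m) x).symm) z (chartField x Y z))
    (x := extChartAt (𝓡 m) x x))) _).trans ?_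
  rw [fderiv_clm_apply hd hY', add_comm]
  rfl

/-- `X(Y G) - Y(X G) = [X, Y] G` for a vector valued function `G`. -/
lemma mvfderiv_mvfderiv_sub (hG : ContMDiffAt (𝓡 m) 𝓘(ℝ, E') 2 G x)
    {X Y : ∀ y : M, TangentSpace (𝓡 m) y}
    (hX : DiffAlongAt m (fun y : M => y) X x) (hY : DiffAlongAt m (fun y : M => y) Y x) :
    mvfderiv (𝓡 m) (fun y => mvfderiv (𝓡 m) G y (Y y)) x (X x)
      - mvfderiv (𝓡 m) (fun y => mvfderiv (𝓡 m) G y (X y)) x (Y x)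
      = mvfderiv (𝓡 m) G x (mlieBracket (𝓡 m) X Y x) := by
  have h2 : ContDiffAt ℝ 2 _ _ := contDiffAt_comp_extChartAt_symm (k := 2) hG
  have hs := h2.isSymmSndFDerivAt (by simp)
  have hb := (eventually_mvfderiv_eq (hG.of_le (by norm_num))
    (mlieBracket (𝓡 m) X Y)).self_of_nhds
  rw [hb, mvfderiv_mvfderiv hG hX, mvfderiv_mvfderiv hG hY, chartField_mlieBracket, map_sub, hs.eq]
  abel

lemma coordAt_eq_mfderiv (q y : N) (hy : y ∈ (chartAt (EuclideanSpace ℝ (Fin n)) q).source) :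
    coordAt q y = mfderiv (𝓡 n) 𝓘(ℝ, EuclideanSpace ℝ (Fin n)) (extChartAt (𝓡 n) q) y :=
  TangentBundle.continuousLinearMapAt_trivializationAt hy

/-- The trivialization of the tangent bundle at `F x` is the derivative of the chart there, so the
coordinates of `dF Y` are derivatives of one vector valued function, the chart composed with `F`. -/
lemma coordAlong_mfderiv (hF : ContMDiffAt (𝓡 m) (𝓡 n) 1 F x)
    (Y : ∀ y : M, TangentSpace (𝓡 m) y) :
    ∀ᶠ y in 𝓝 x, coordAlong F (fun y => mfderiv (𝓡 m) (𝓡 n) F y (Y y)) x y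
      = mvfderiv (𝓡 m) (fun y => extChartAt (𝓡 n) (F x) (F y)) y (Y y) := by
  filter_upwards [hF.continuousAt (mem_baseSet_nhds n (F x)),
    hF.continuousAt ((chartAt (EuclideanSpace ℝ (Fin n)) (F x)).open_source.mem_nhds
      (mem_chart_source _ (F x))), (contMDiffAt_iff_contMDiffAt_nhds (by simp)).1 hF]
    with y hy hy' hFy
  rw [coordAlong_eq hy, coordAt_eq_mfderiv _ _ hy',
    mvfderiv_comp_vec (mdifferentiableAt_extChartAt hy') (hFy.mdifferentiableAt (by simp))]
  rfl

variable [RiemannianBundle (fun y : N => TangentSpace (𝓡 n) y)]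
  [IsContMDiffRiemannianBundle (𝓡 n) ∞ (EuclideanSpace ℝ (Fin n))
      (fun y : N => TangentSpace (𝓡 n) y)]

/-- The connection is torsion free. -/
theorem covAlong_mfderiv_sub (hF : ContMDiffAt (𝓡 m) (𝓡 n) ∞ F x)
    {X Y : ∀ y : M, TangentSpace (𝓡 m) y}
    (hX : DiffAlongAt m (fun y : M => y) X x) (hY : DiffAlongAt m (fun y : M => y) Y x) :
    covAlong F (fun y => mfderiv (𝓡 m) (𝓡 n) F y (Y y)) x (X x)
      - covAlong F (fun y => mfderiv (𝓡 m) (𝓡 n) F y (X y)) x (Y x)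
      = mfderiv (𝓡 m) (𝓡 n) F x (mlieBracket (𝓡 m) X Y x) := by
  have hF1 : ContMDiffAt (𝓡 m) (𝓡 n) 1 F x := hF.of_le (by simp)
  have hG : ContMDiffAt (𝓡 m) 𝓘(ℝ, EuclideanSpace ℝ (Fin n)) 2
      (fun y => extChartAt (𝓡 n) (F x) (F y)) x :=
    ((contMDiffAt_extChartAt (n := ∞)).comp x hF).of_le ENat.LEInfty.out
  have hx := (FiberBundle.mem_baseSet_trivializationAt' (F := EuclideanSpace ℝ (Fin n))
    (E := (TangentSpace (𝓡 n) : N → Type _)) (F x))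
  have hb := (coordAlong_mfderiv hF1 (mlieBracket (𝓡 m) X Y)).self_of_nhds
  rw [coordAlong_eq hx] at hb
  -- The two Christoffel terms cancel by symmetry; what remains is the commutator of `X` and `Y`
  -- acting on the chart composed with `F`.
  rw [covAlong_def, covAlong_def, mvfderiv_congr (coordAlong_mfderiv hF1 X),
    mvfderiv_congr (coordAlong_mfderiv hF1 Y), christoffel_symm, add_sub_add_right_eq_sub,
    ← map_sub, mvfderiv_mvfderiv_sub hG hX hY, ← hb, symm_coordAt _ _ hx]

lemma leviCivita_sub {X Y : ∀ y : M, TangentSpace (𝓡 m) y}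
    [RiemannianBundle (fun y : M => TangentSpace (𝓡 m) y)]
    [IsContMDiffRiemannianBundle (𝓡 m) ∞ (EuclideanSpace ℝ (Fin m))
      (fun y : M => TangentSpace (𝓡 m) y)]
    (hX : DiffAlongAt m (fun y : M => y) X x) (hY : DiffAlongAt m (fun y : M => y) Y x) :
    leviCivita Y x (X x) - leviCivita X x (Y x) = mlieBracket (𝓡 m) X Y x := by
  have h := covAlong_mfderiv_sub (F := fun y : M => y) contMDiffAt_id hX hY
  simp only [mfderiv_id_apply] at h
  exact h

end Torsion

/-! ### Smooth local orthonormal frames. -/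

section Frame

variable {n : ℕ} {N : Type*} [TopologicalSpace N]
  [ChartedSpace (EuclideanSpace ℝ (Fin n)) N] [IsManifold (𝓡 n) ∞ N]
  [RiemannianBundle (fun y : N => TangentSpace (𝓡 n) y)]
  [IsContMDiffRiemannianBundle (𝓡 n) ∞ (EuclideanSpace ℝ (Fin n))
      (fun y : N => TangentSpace (𝓡 n) y)]
  {m : ℕ} {M : Type*} [TopologicalSpace M]
  [ChartedSpace (EuclideanSpace ℝ (Fin m)) M] [IsManifold (𝓡 m) ∞ M]

/-- `E` is a smooth local orthonormal frame near `q`. -/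
structure IsOrthonormalFrameAt (E : Fin n → ∀ y : N, TangentSpace (𝓡 n) y) (q : N) : Prop where
  smooth : ∀ᶠ y in 𝓝 q, ∀ k, SmoothAlongAt n (fun y : N => y) (E k) y
  orthonormal : ∀ᶠ y in 𝓝 q, Orthonormal ℝ fun k => E k y

/-- The structure asks for smoothness at all nearby points because smoothness at `q` alone would not
propagate. This allows pointwise frame formulas to be used on a neighbourhood and then
differentiated. -/
lemma IsOrthonormalFrameAt.eventually {E : Fin n → ∀ y : N, TangentSpace (𝓡 n) y} {q : N}
    (h : IsOrthonormalFrameAt E q) : ∀ᶠ y in 𝓝 q, IsOrthonormalFrameAt E y := by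
  filter_upwards [eventually_eventually_nhds.2 h.smooth,
    eventually_eventually_nhds.2 h.orthonormal] with y h1 h2
  exact ⟨h1, h2⟩

lemma sum_inner_smul {y : N} {e : Fin n → TangentSpace (𝓡 n) y} (he : Orthonormal ℝ e)
    (u : TangentSpace (𝓡 n) y) : ∑ k, (inner ℝ (e k) u : ℝ) • e k = u := by
  have hcard : Fintype.card (Fin n) = Module.finrank ℝ (TangentSpace (𝓡 n) y) := by
    have : Module.finrank ℝ (TangentSpace (𝓡 n) y)
      = Module.finrank ℝ (EuclideanSpace ℝ (Fin n)) := rfl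
    simp [this]
  let b : OrthonormalBasis (Fin n) ℝ (TangentSpace (𝓡 n) y) :=
    OrthonormalBasis.mk he (he.linearIndependent.span_eq_top_of_card_eq_finrank' hcard).ge
  have h := b.sum_repr' u
  simpa [b] using h

lemma eventually_smoothAlongAt_coordField (q : N) (u : TangentSpace (𝓡 n) q) :
    ∀ᶠ y in 𝓝 q, SmoothAlongAt n (fun y : N => y) (coordField q u) y := by
  obtain ⟨s, hs, h⟩ := FiberBundle.exists_contMDiffOn_extend (k := ∞) (𝓡 n)
    (EuclideanSpace ℝ (Fin n)) u
  filter_upwards [eventually_eventually_nhds.2 hs] with y hy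
  exact h.contMDiffAt hy

lemma linearIndependent_coordField (q : N) : ∀ᶠ y in 𝓝 q, LinearIndependent ℝ fun k : Fin n =>
    coordField q ((trivializationAt (EuclideanSpace ℝ (Fin n)) (TangentSpace (𝓡 n) : N → Type _)
        q).symmL ℝ q (EuclideanSpace.single k 1)) y := by
  filter_upwards [mem_baseSet_nhds n q] with y hy
  have hq := (FiberBundle.mem_baseSet_trivializationAt' (F := EuclideanSpace ℝ (Fin n))
    (E := (TangentSpace (𝓡 n) : N → Type _)) q)
  simp only [coordField_eq _ _ hy, coordAt_symm _ _ hq]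
  have h := (EuclideanSpace.basisFun (Fin n) ℝ).orthonormal.linearIndependent.map'
    ((trivializationAt (EuclideanSpace ℝ (Fin n)) (TangentSpace (𝓡 n) : N → Type _)
        q).symmL ℝ y : EuclideanSpace ℝ (Fin n) →ₗ[ℝ] TangentSpace (𝓡 n) y)
    (LinearMap.ker_eq_bot_of_injective (Function.LeftInverse.injective (g := coordAt q y)
      fun a => coordAt_symm q y hy a))
  simpa [Function.comp_def] using h

/-- The unnormalized Gram–Schmidt recursion involves only inner products and division by `|g_i|²`,
which is nonzero at `q` by linear independence there. The recursion is written with inverses so that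
each factor is visibly smooth. -/
lemma smoothAlongAt_gramSchmidt {f : Fin n → ∀ y : N, TangentSpace (𝓡 n) y} {q : N}
    (hf : ∀ k, SmoothAlongAt n (fun y : N => y) (f k) q)
    (hli : LinearIndependent ℝ fun k => f k q) (k : Fin n) :
    SmoothAlongAt n (fun y : N => y)
      (fun y => InnerProductSpace.gramSchmidt ℝ (fun j => f j y) k) q := by
  induction k using WellFoundedLT.induction with
  | ind k ih =>
    have h (y : N) : InnerProductSpace.gramSchmidt ℝ (fun j => f j y) k = f k y
        - ∑ i ∈ Finset.Iio k, ((inner ℝ (InnerProductSpace.gramSchmidt ℝ (fun j => f j y) i) (f k y))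
          * (inner ℝ (InnerProductSpace.gramSchmidt ℝ (fun j => f j y) i)
            (InnerProductSpace.gramSchmidt ℝ (fun j => f j y) i) : ℝ)⁻¹)
          • InnerProductSpace.gramSchmidt ℝ (fun j => f j y) i := by
      have h := InnerProductSpace.gramSchmidt_def'' ℝ (fun j => f j y) k
      simp only [real_inner_self_eq_norm_sq, ← div_eq_mul_inv]
      exact eq_sub_of_add_eq h.symm
    simp only [h]
    refine (hf k).sub (SmoothAlongAt.sum (F := fun y : N => y) _ contMDiffAt_id fun i hi => ?_)
    have hi' := ih i (Finset.mem_Iio.1 hi)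
    refine SmoothAlongAt.smul (F := fun y : N => y) ((hi'.inner (hf k)).mul ?_) hi'
    refine (contDiffAt_inv ℝ ?_).contMDiffAt.comp q (hi'.inner hi')
    rw [real_inner_self_eq_norm_sq]
    exact pow_ne_zero _ (norm_ne_zero_iff.2 (InnerProductSpace.gramSchmidt_ne_zero i hli))

lemma SmoothAlongAt.norm {F : M → N}
    {V : ∀ y : M, TangentSpace (𝓡 n) (F y)} {x : M} (hV : SmoothAlongAt m F V x) (h : V x ≠ 0) :
    ContMDiffAt (𝓡 m) 𝓘(ℝ, ℝ) ∞ (fun y => ‖V y‖) x := by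
  simp only [norm_eq_sqrt_real_inner]
  refine (Real.contDiffAt_sqrt ?_).contMDiffAt.comp x (hV.inner hV)
  rw [real_inner_self_eq_norm_sq]
  exact pow_ne_zero _ (norm_ne_zero_iff.2 h)

lemma SmoothAlongAt.norm_inv {F : M → N}
    {V : ∀ y : M, TangentSpace (𝓡 n) (F y)} {x : M} (hV : SmoothAlongAt m F V x) (h : V x ≠ 0) :
    ContMDiffAt (𝓡 m) 𝓘(ℝ, ℝ) ∞ (fun y => ‖V y‖⁻¹) x :=
  (contDiffAt_inv ℝ (norm_ne_zero_iff.2 h)).contMDiffAt.comp x (hV.norm h)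

/-- Smooth local orthonormal frames exist. -/
theorem exists_isOrthonormalFrameAt (q : N) :
    ∃ E : Fin n → ∀ y : N, TangentSpace (𝓡 n) y, IsOrthonormalFrameAt E q := by
  refine ⟨fun k y => InnerProductSpace.gramSchmidtNormed ℝ (fun k : Fin n =>
    coordField q ((trivializationAt (EuclideanSpace ℝ (Fin n)) (TangentSpace (𝓡 n) : N → Type _)
        q).symmL ℝ q (EuclideanSpace.single k 1)) y) k, ?_, ?_⟩
  · filter_upwards [linearIndependent_coordField (n := n) q, Filter.eventually_all.2 fun k : Fin n =>
      eventually_smoothAlongAt_coordField q ((trivializationAt (EuclideanSpace ℝ (Fin n))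
        (TangentSpace (𝓡 n) : N → Type _) q).symmL ℝ q (EuclideanSpace.single k 1))] with y h1 h2 k
    have h := smoothAlongAt_gramSchmidt (n := n) (q := y) h2 h1 k
    have h3 := SmoothAlongAt.norm_inv (n := n) (m := n) (F := fun y : N => y) h
      (InnerProductSpace.gramSchmidt_ne_zero k h1)
    exact SmoothAlongAt.smul h3 h
  · filter_upwards [linearIndependent_coordField (n := n) q] with y hy
    exact InnerProductSpace.gramSchmidtNormed_orthonormal hy

end Frame

/-! ### Koszul's formula and smoothness of the Levi-Civita derivative. -/

section Koszul

variable {n : ℕ} {N : Type*} [TopologicalSpace N]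
  [ChartedSpace (EuclideanSpace ℝ (Fin n)) N] [IsManifold (𝓡 n) ∞ N]
  [RiemannianBundle (fun y : N => TangentSpace (𝓡 n) y)]
  [IsContMDiffRiemannianBundle (𝓡 n) ∞ (EuclideanSpace ℝ (Fin n))
      (fun y : N => TangentSpace (𝓡 n) y)]
  {m : ℕ} {M : Type*} [TopologicalSpace M]
  [ChartedSpace (EuclideanSpace ℝ (Fin m)) M] [IsManifold (𝓡 m) ∞ M]

variable {F : M → N} {x : M} {X Y Z : ∀ y : M, TangentSpace (𝓡 m) y}

open VectorField

lemma DiffAlongAt.mfderiv (hX : DiffAlongAt m (fun y : M => y) X x)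
    (hF : ContMDiff (𝓡 m) (𝓡 n) ∞ F) :
    DiffAlongAt m F (fun y => mfderiv (𝓡 m) (𝓡 n) F y (X y)) x := by
  have := ((hF.contMDiff_tangentMap (m := ∞) (by simp)).contMDiffAt
    (x := (⟨x, X x⟩ : TangentBundle (𝓡 m) M))).mdifferentiableAt (by simp)
  exact MDifferentiableAt.comp (I' := (𝓡 m).tangent) x this hX

/-- In the chart at `x` the derivative is the Fréchet derivative of the local representative applied
to the coordinates of `X`, and both depend smoothly on the point. -/
lemma contMDiffAt_mvfderiv {f : M → ℝ} (hf : ContMDiffAt (𝓡 m) 𝓘(ℝ, ℝ) ∞ f x)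
    (hX : SmoothAlongAt m (fun y : M => y) X x) :
    ContMDiffAt (𝓡 m) 𝓘(ℝ, ℝ) ∞ (fun y => mvfderiv (𝓡 m) f y (X y)) x := by
  have h1 : ContMDiffAt (𝓡 m) 𝓘(ℝ, EuclideanSpace ℝ (Fin m) →L[ℝ] ℝ) ∞
      (fun y => fderiv ℝ (f ∘ (extChartAt (𝓡 m) x).symm) (extChartAt (𝓡 m) x y)) x :=
    ((contDiffAt_comp_extChartAt_symm (k := ⊤) hf).fderiv_right (m := ∞)
      (by simp)).contMDiffAt.comp x contMDiffAt_extChartAt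
  refine (h1.clm_apply (smoothAlongAt_iff.1 hX).2).congr_of_eventuallyEq ?_
  filter_upwards [eventually_mvfderiv_eq (hf.of_le (by simp)) X,
    eventually_eq_inverse_mpullback X x, mem_baseSet_nhds m x,
    (chartAt (EuclideanSpace ℝ (Fin m)) x).open_source.mem_nhds (mem_chart_source _ x)]
    with y h2 h3 h4 h5
  rw [h2, coordAlong_eq (F := fun y : M => y) (x := x) h4, coordAt_eq_mfderiv _ _ h5]
  exact congrArg _ h3.symm

variable [RiemannianBundle (fun x : M => TangentSpace (𝓡 m) x)]
  [IsContMDiffRiemannianBundle (𝓡 m) ∞ (EuclideanSpace ℝ (Fin m))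
      (fun x : M => TangentSpace (𝓡 m) x)]

lemma isIsometricImmersion_id : IsIsometricImmersion m m (fun y : M => y) :=
  ⟨contMDiff_id, fun x v w => by simp only [mfderiv_id_apply]⟩

/-- Koszul's formula. -/
lemma koszul (hF : IsIsometricImmersion m n F) (hX : DiffAlongAt m (fun y : M => y) X x)
    (hY : DiffAlongAt m (fun y : M => y) Y x) (hZ : DiffAlongAt m (fun y : M => y) Z x) :
    2 * (inner ℝ (covAlong F (fun y => mfderiv (𝓡 m) (𝓡 n) F y (Y y)) x (X x))
        (mfderiv (𝓡 m) (𝓡 n) F x (Z x)) : ℝ)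
      = mvfderiv (𝓡 m) (fun y => (inner ℝ (Y y) (Z y) : ℝ)) x (X x)
        + mvfderiv (𝓡 m) (fun y => (inner ℝ (X y) (Z y) : ℝ)) x (Y x)
        - mvfderiv (𝓡 m) (fun y => (inner ℝ (X y) (Y y) : ℝ)) x (Z x)
        + (inner ℝ (mlieBracket (𝓡 m) X Y x) (Z x) : ℝ)
        - (inner ℝ (mlieBracket (𝓡 m) X Z x) (Y x) : ℝ)
        - (inner ℝ (mlieBracket (𝓡 m) Y Z x) (X x) : ℝ) := by
  have h1 := mvfderiv_inner (hY.mfderiv hF.smooth) (hZ.mfderiv hF.smooth) (X x)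
  have h2 := mvfderiv_inner (hX.mfderiv hF.smooth) (hZ.mfderiv hF.smooth) (Y x)
  have h3 := mvfderiv_inner (hX.mfderiv hF.smooth) (hY.mfderiv hF.smooth) (Z x)
  have t1 := covAlong_mfderiv_sub hF.smooth.contMDiffAt hX hY
  have t2 := covAlong_mfderiv_sub hF.smooth.contMDiffAt hX hZ
  have t3 := covAlong_mfderiv_sub hF.smooth.contMDiffAt hY hZ
  simp only [hF.isometric] at h1 h2 h3
  rw [h1, h2, h3, ← hF.isometric x _ (Z x), ← hF.isometric x _ (Y x), ← hF.isometric x _ (X x),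
    ← t1, ← t2, ← t3]
  simp only [inner_sub_left]
  rw [real_inner_comm (covAlong F (fun y => mfderiv (𝓡 m) (𝓡 n) F y (Z y)) x (X x)),
    real_inner_comm (covAlong F (fun y => mfderiv (𝓡 m) (𝓡 n) F y (Z y)) x (Y x)),
    real_inner_comm (covAlong F (fun y => mfderiv (𝓡 m) (𝓡 n) F y (Y y)) x (Z x))]
  ring

lemma koszul_leviCivita (hX : DiffAlongAt m (fun y : M => y) X x)
    (hY : DiffAlongAt m (fun y : M => y) Y x) (hZ : DiffAlongAt m (fun y : M => y) Z x) :
    2 * (inner ℝ (leviCivita Y x (X x)) (Z x) : ℝ)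
      = mvfderiv (𝓡 m) (fun y => (inner ℝ (Y y) (Z y) : ℝ)) x (X x)
        + mvfderiv (𝓡 m) (fun y => (inner ℝ (X y) (Z y) : ℝ)) x (Y x)
        - mvfderiv (𝓡 m) (fun y => (inner ℝ (X y) (Y y) : ℝ)) x (Z x)
        + (inner ℝ (mlieBracket (𝓡 m) X Y x) (Z x) : ℝ)
        - (inner ℝ (mlieBracket (𝓡 m) X Z x) (Y x) : ℝ)
        - (inner ℝ (mlieBracket (𝓡 m) Y Z x) (X x) : ℝ) := by
  have h := koszul isIsometricImmersion_id hX hY hZ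
  simp only [mfderiv_id_apply] at h
  exact h

/-- The tangential part of `∇^F (dF Y)` is `dF (∇ Y)`. -/
lemma inner_covAlong_mfderiv (hF : IsIsometricImmersion m n F)
    (hY : DiffAlongAt m (fun y : M => y) Y x) (v w : TangentSpace (𝓡 m) x) :
    (inner ℝ (covAlong F (fun y => mfderiv (𝓡 m) (𝓡 n) F y (Y y)) x v)
        (mfderiv (𝓡 m) (𝓡 n) F x w) : ℝ) = inner ℝ (leviCivita Y x v) w := by
  -- The right-hand side of Koszul's formula involves only the metric and brackets of `M`. It is
  -- therefore the same for `F` and for the identity.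
  have h1 := koszul hF (diffAlongAt_coordField x v) hY (diffAlongAt_coordField x w)
  have h2 := koszul_leviCivita (diffAlongAt_coordField x v) hY (diffAlongAt_coordField x w)
  simp only [coordField_self] at h1 h2
  linarith

lemma smoothAlongAt_mlieBracket (hX : SmoothAlongAt m (fun y : M => y) X x)
    (hY : SmoothAlongAt m (fun y : M => y) Y x) :
    SmoothAlongAt m (fun y : M => y) (mlieBracket (𝓡 m) X Y) x := by
  have : IsManifold (𝓡 m) (((⊤ : ℕ∞) : ℕ∞ω) + 1) M := inferInstanceAs (IsManifold (𝓡 m) ∞ M)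
  have : IsManifold (𝓡 m) (minSmoothness ℝ 2) M := by
    rw [minSmoothness_of_isRCLikeNormedField]
    exact IsManifold.of_le (n := ∞) ENat.LEInfty.out
  exact ContMDiffAt.mlieBracket_vectorField (m := ⊤) (n := ⊤) hX hY (by simp)

/-- At each `y` the definition uses the chart at `y`, a choice without regularity in `y`. Koszul's
formula expresses the components in a smooth orthonormal frame without charts. -/
lemma smoothAlongAt_leviCivita (hX : SmoothAlongAt m (fun y : M => y) X x)
    (hY : SmoothAlongAt m (fun y : M => y) Y x) :
    SmoothAlongAt m (fun y : M => y) (fun y => leviCivita Y y (X y)) x := by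
  obtain ⟨E, hE⟩ := exists_isOrthonormalFrameAt (n := m) x
  have hEx := hE.smooth.self_of_nhds
  have h : ∀ k, ContMDiffAt (𝓡 m) 𝓘(ℝ, ℝ) ∞
      (fun y => (inner ℝ (leviCivita Y y (X y)) (E k y) : ℝ)) x := by
    intro k
    have hs : ContMDiffAt (𝓡 m) 𝓘(ℝ, ℝ) ∞ (fun y => (1 / 2 : ℝ) *
        (mvfderiv (𝓡 m) (fun y => (inner ℝ (Y y) (E k y) : ℝ)) y (X y)
        + mvfderiv (𝓡 m) (fun y => (inner ℝ (X y) (E k y) : ℝ)) y (Y y)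
        - mvfderiv (𝓡 m) (fun y => (inner ℝ (X y) (Y y) : ℝ)) y (E k y)
        + (inner ℝ (mlieBracket (𝓡 m) X Y y) (E k y) : ℝ)
        - (inner ℝ (mlieBracket (𝓡 m) X (E k) y) (Y y) : ℝ)
        - (inner ℝ (mlieBracket (𝓡 m) Y (E k) y) (X y) : ℝ))) x :=
      contMDiffAt_const.mul ((((((contMDiffAt_mvfderiv (hY.inner (hEx k)) hX).add
        (contMDiffAt_mvfderiv (hX.inner (hEx k)) hY)).sub
        (contMDiffAt_mvfderiv (hX.inner hY) (hEx k))).add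
        ((smoothAlongAt_mlieBracket hX hY).inner (hEx k))).sub ((smoothAlongAt_mlieBracket hX (hEx k)).inner hY)).sub
        ((smoothAlongAt_mlieBracket hY (hEx k)).inner hX))
    refine hs.congr_of_eventuallyEq ?_
    filter_upwards [hX.eventually_diffAlongAt, hY.eventually_diffAlongAt,
      (hEx k).eventually_diffAlongAt] with y h1 h2 h3
    rw [← koszul_leviCivita h1 h2 h3]
    ring
  refine (SmoothAlongAt.sum (F := fun y : M => y) Finset.univ contMDiffAt_id fun k _ =>
    SmoothAlongAt.smul (h k) (hEx k)).congr ?_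
  filter_upwards [hE.orthonormal] with y hy
  conv_lhs => rw [← sum_inner_smul hy (leviCivita Y y (X y))]
  exact Finset.sum_congr rfl fun k _ => by rw [real_inner_comm]

end Koszul

/-! ### The pull-back connection and its curvature as a tensor. -/

section Curvature

variable {n : ℕ} {N : Type*} [TopologicalSpace N]
  [ChartedSpace (EuclideanSpace ℝ (Fin n)) N] [IsManifold (𝓡 n) ∞ N]
  [RiemannianBundle (fun y : N => TangentSpace (𝓡 n) y)]
  [IsContMDiffRiemannianBundle (𝓡 n) ∞ (EuclideanSpace ℝ (Fin n))
      (fun y : N => TangentSpace (𝓡 n) y)]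
  {m : ℕ} {M : Type*} [TopologicalSpace M]
  [ChartedSpace (EuclideanSpace ℝ (Fin m)) M] [IsManifold (𝓡 m) ∞ M]

variable {F : M → N} {x : M} {X Y : ∀ y : M, TangentSpace (𝓡 m) y}
  {V : ∀ y : M, TangentSpace (𝓡 n) (F y)}

open VectorField

lemma covAlong_zero (hF : MDifferentiableAt (𝓡 m) (𝓡 n) F x) (v : TangentSpace (𝓡 m) x) :
    covAlong F (fun y => (0 : TangentSpace (𝓡 n) (F y))) x v = 0 := by
  have h := covAlong_smul (f := fun _ => (0 : ℝ)) mdifferentiableAt_const (diffAlongAt_zero hF) v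
  simpa [mvfderiv_const] using h

lemma covAlong_sum {ι : Type*} (s : Finset ι) {V : ι → ∀ y : M, TangentSpace (𝓡 n) (F y)}
    (hF : MDifferentiableAt (𝓡 m) (𝓡 n) F x) (hV : ∀ i ∈ s, DiffAlongAt m F (V i) x)
    (v : TangentSpace (𝓡 m) x) :
    covAlong F (fun y => ∑ i ∈ s, V i y) x v = ∑ i ∈ s, covAlong F (V i) x v := by
  classical
  induction s using Finset.induction_on with
  | empty => simpa using covAlong_zero hF v
  | insert a s ha ih =>
    simp only [Finset.sum_insert ha]
    rw [covAlong_add (hV a (by simp)) (DiffAlongAt.sum s hF fun i hi => hV i (by simp [hi])),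
      ih fun i hi => hV i (by simp [hi])]

lemma covAlong_neg (hV : DiffAlongAt m F V x) (v : TangentSpace (𝓡 m) x) :
    covAlong F (fun y => -V y) x v = -covAlong F V x v := by
  have h := covAlong_smul (f := fun _ => (-1 : ℝ)) mdifferentiableAt_const hV v
  simpa [mvfderiv_const] using h

lemma mdiff_of_contMDiffAt {f : M → ℝ} (hf : ContMDiffAt (𝓡 m) 𝓘(ℝ, ℝ) ∞ f x) :
    MDifferentiableAt (𝓡 m) 𝓘(ℝ, ℝ) f x := hf.mdifferentiableAt (by simp)

lemma eventually_mdiff_of_contMDiffAt {f : M → ℝ} (hf : ContMDiffAt (𝓡 m) 𝓘(ℝ, ℝ) ∞ f x) :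
    ∀ᶠ y in 𝓝 x, MDifferentiableAt (𝓡 m) 𝓘(ℝ, ℝ) f y := by
  have h1 : ContMDiffAt (𝓡 m) 𝓘(ℝ, ℝ) 1 f x := hf.of_le (by simp)
  filter_upwards [(contMDiffAt_iff_contMDiffAt_nhds (by simp)).1 h1] with y hy
  exact hy.mdifferentiableAt (by simp)

/-- Expansion of a vector field along `F` in an orthonormal frame of the target. -/
lemma IsOrthonormalFrameAt.eventually_eq {E : Fin n → ∀ y : N, TangentSpace (𝓡 n) y}
    (hE : IsOrthonormalFrameAt E (F x)) (hF : ContinuousAt F x)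
    (V : ∀ y : M, TangentSpace (𝓡 n) (F y)) :
    ∀ᶠ y in 𝓝 x, V y = ∑ k, (inner ℝ (E k (F y)) (V y) : ℝ) • E k (F y) := by
  filter_upwards [hF.eventually hE.orthonormal] with y hy
  exact (sum_inner_smul hy (V y)).symm

lemma IsOrthonormalFrameAt.smoothAlongAt {E : Fin n → ∀ y : N, TangentSpace (𝓡 n) y}
    (hE : IsOrthonormalFrameAt E (F x)) (hF : ContMDiffAt (𝓡 m) (𝓡 n) ∞ F x) (k : Fin n) :
    SmoothAlongAt m F (fun y => E k (F y)) x :=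
  SmoothAlongAt.comp (hE.smooth.self_of_nhds k) hF

/-- The covariant derivative of a vector field along `F` in an orthonormal frame. -/
lemma IsOrthonormalFrameAt.covAlong_eq {E : Fin n → ∀ y : N, TangentSpace (𝓡 n) y}
    (hE : IsOrthonormalFrameAt E (F x)) (hV : DiffAlongAt m F V x) (v : TangentSpace (𝓡 m) x) :
    covAlong F V x v = ∑ k,
      (mvfderiv (𝓡 m) (fun y => (inner ℝ (E k (F y)) (V y) : ℝ)) x v • E k (F x)
        + (inner ℝ (E k (F x)) (V x) : ℝ)
          • leviCivita (E k) (F x) (mfderiv (𝓡 m) (𝓡 n) F x v)) := by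
  have hF := (diffAlongAt_iff.1 hV).1
  have hEk (k) : DiffAlongAt m F (fun y => E k (F y)) x :=
    DiffAlongAt.comp (hE.smooth.self_of_nhds k).diffAlongAt hF
  rw [covAlong_congr (hE.eventually_eq hF.continuousAt V), covAlong_sum _ hF
    fun k _ => ((hEk k).smul ((hEk k).inner hV))]
  refine Finset.sum_congr rfl fun k _ => ?_
  rw [covAlong_smul ((hEk k).inner hV) (hEk k),
    covAlong_comp (hE.smooth.self_of_nhds k).diffAlongAt hF]

lemma leviCivita_sum_dir (Z : ∀ y : N, TangentSpace (𝓡 n) y) {q : N} {ι : Type*} (s : Finset ι)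
    (v : ι → TangentSpace (𝓡 n) q) :
    leviCivita Z q (∑ i ∈ s, v i) = ∑ i ∈ s, leviCivita Z q (v i) :=
  covAlong_sum_dir (F := fun y : N => y) Z s v

lemma leviCivita_smul_dir (Z : ∀ y : N, TangentSpace (𝓡 n) y) {q : N} (r : ℝ)
    (v : TangentSpace (𝓡 n) q) : leviCivita Z q (r • v) = r • leviCivita Z q v :=
  covAlong_smul_dir (F := fun y : N => y) Z r v

lemma leviCivita_expand {E : Fin n → ∀ y : N, TangentSpace (𝓡 n) y}
    {q : N} (hE : Orthonormal ℝ fun k => E k q) (Z : ∀ y : N, TangentSpace (𝓡 n) y)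
    (w : TangentSpace (𝓡 n) q) :
    leviCivita Z q w = ∑ j, (inner ℝ (E j q) w : ℝ) • leviCivita Z q (E j q) := by
  conv_lhs => rw [← sum_inner_smul hE w, leviCivita_sum_dir]
  simp only [leviCivita_smul_dir]

/-- The covariant derivative of a smooth field along `F` is smooth. -/
theorem smoothAlongAt_covAlong (hF : ContMDiff (𝓡 m) (𝓡 n) ∞ F) (hV : SmoothAlongAt m F V x)
    (hX : SmoothAlongAt m (fun y : M => y) X x) :
    SmoothAlongAt m F (fun y => covAlong F V y (X y)) x := by
  obtain ⟨E, hE⟩ := exists_isOrthonormalFrameAt (n := n) (F x)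
  have hEk (k) := hE.smoothAlongAt hF.contMDiffAt k
  have hdX : SmoothAlongAt m F (fun y => mfderiv (𝓡 m) (𝓡 n) F y (X y)) x :=
    SmoothAlongAt.mfderiv hX hF
  -- Expanding both `V` and `dF X` in the frame leaves derivatives of functions on `M` and the
  -- fields `∇_{E_j} E_k` of `N` composed with `F`, whose smoothness is already known.
  refine (SmoothAlongAt.sum (F := F)
    (V := fun k y => mvfderiv (𝓡 m) (fun y => (inner ℝ (E k (F y)) (V y) : ℝ)) y (X y) • E k (F y)
        + (inner ℝ (E k (F y)) (V y) : ℝ) • ∑ j, (inner ℝ (E j (F y))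
          (mfderiv (𝓡 m) (𝓡 n) F y (X y)) : ℝ) • leviCivita (E k) (F y) (E j (F y)))
    Finset.univ hF.contMDiffAt fun k _ => ?_).congr ?_
  · refine SmoothAlongAt.add (SmoothAlongAt.smul (contMDiffAt_mvfderiv ((hEk k).inner hV) hX)
      (hEk k)) (SmoothAlongAt.smul ((hEk k).inner hV)
      (SmoothAlongAt.sum (F := F) Finset.univ hF.contMDiffAt fun j _ =>
        SmoothAlongAt.smul ((hEk j).inner hdX) ?_))
    exact SmoothAlongAt.comp (Z := fun q => leviCivita (E k) q (E j q))
      (smoothAlongAt_leviCivita (hE.smooth.self_of_nhds j)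
      (hE.smooth.self_of_nhds k)) hF.contMDiffAt
  · filter_upwards [hV.eventually_diffAlongAt, hF.continuous.continuousAt.eventually hE.eventually]
      with y hy hEy
    rw [hEy.covAlong_eq hy]
    refine Finset.sum_congr rfl fun k _ => ?_
    rw [leviCivita_expand hEy.orthonormal.self_of_nhds]

/-- The curvature of the pull-back connection. -/
def curvatureAlong (F : M → N) (X Y : ∀ y : M, TangentSpace (𝓡 m) y)
    (V : ∀ y : M, TangentSpace (𝓡 n) (F y)) (x : M) : TangentSpace (𝓡 n) (F x) :=
  covAlong F (fun y => covAlong F V y (Y y)) x (X x)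
    - covAlong F (fun y => covAlong F V y (X y)) x (Y x)
    - covAlong F V x (mlieBracket (𝓡 m) X Y x)

/-- Tensoriality in `V`: the mixed first-order terms are symmetric in `X` and `Y`, and the terms
`X(Yf) - Y(Xf)` are absorbed by the bracket term. -/
lemma curvatureAlong_smul (hF : ContMDiff (𝓡 m) (𝓡 n) ∞ F)
    (hX : SmoothAlongAt m (fun y : M => y) X x)
    (hY : SmoothAlongAt m (fun y : M => y) Y x) {f : M → ℝ}
    (hf : ContMDiffAt (𝓡 m) 𝓘(ℝ, ℝ) ∞ f x) (hV : SmoothAlongAt m F V x) :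
    curvatureAlong F X Y (fun y => f y • V y) x = f x • curvatureAlong F X Y V x := by
  have key {X Y : ∀ y : M, TangentSpace (𝓡 m) y} (hX : SmoothAlongAt m (fun y : M => y) X x)
    (hY : SmoothAlongAt m (fun y : M => y) Y x) :
      covAlong F (fun y => covAlong F (fun y => f y • V y) y (Y y)) x (X x)
      = mvfderiv (𝓡 m) (fun y => mvfderiv (𝓡 m) f y (Y y)) x (X x) • V x
        + mvfderiv (𝓡 m) f x (Y x) • covAlong F V x (X x)
        + (mvfderiv (𝓡 m) f x (X x) • covAlong F V x (Y x)
        + f x • covAlong F (fun y => covAlong F V y (Y y)) x (X x)) := by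
    have h : ∀ᶠ y in 𝓝 x, covAlong F (fun y => f y • V y) y (Y y)
        = mvfderiv (𝓡 m) f y (Y y) • V y + f y • covAlong F V y (Y y) := by
      filter_upwards [eventually_mdiff_of_contMDiffAt hf, hV.eventually_diffAlongAt] with y h1 h2
      exact covAlong_smul h1 h2 _
    have h1 := mdiff_of_contMDiffAt (contMDiffAt_mvfderiv hf hY)
    have h2 := mdiff_of_contMDiffAt hf
    have h3 := (smoothAlongAt_covAlong hF hV hY).diffAlongAt
    rw [covAlong_congr h, covAlong_add (hV.diffAlongAt.smul h1) (h3.smul h2),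
      covAlong_smul h1 hV.diffAlongAt, covAlong_smul h2 h3]
  have hb := mvfderiv_mvfderiv_sub (hf.of_le ENat.LEInfty.out) hX.diffAlongAt hY.diffAlongAt
  rw [curvatureAlong, key hX hY, key hY hX, covAlong_smul (mdiff_of_contMDiffAt hf) hV.diffAlongAt,
    ← hb, curvatureAlong]
  module

lemma curvatureAlong_add (hF : ContMDiff (𝓡 m) (𝓡 n) ∞ F)
    (hX : SmoothAlongAt m (fun y : M => y) X x)
    (hY : SmoothAlongAt m (fun y : M => y) Y x) {W : ∀ y : M, TangentSpace (𝓡 n) (F y)}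
    (hV : SmoothAlongAt m F V x) (hW : SmoothAlongAt m F W x) :
    curvatureAlong F X Y (fun y => V y + W y) x
      = curvatureAlong F X Y V x + curvatureAlong F X Y W x := by
  have key {X Y : ∀ y : M, TangentSpace (𝓡 m) y} (hX : SmoothAlongAt m (fun y : M => y) X x)
    (hY : SmoothAlongAt m (fun y : M => y) Y x) :
      covAlong F (fun y => covAlong F (fun y => V y + W y) y (Y y)) x (X x)
      = covAlong F (fun y => covAlong F V y (Y y)) x (X x)
        + covAlong F (fun y => covAlong F W y (Y y)) x (X x) := by
    have h : ∀ᶠ y in 𝓝 x, covAlong F (fun y => V y + W y) y (Y y)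
        = covAlong F V y (Y y) + covAlong F W y (Y y) := by
      filter_upwards [hV.eventually_diffAlongAt, hW.eventually_diffAlongAt] with y h1 h2
      exact covAlong_add h1 h2 _
    rw [covAlong_congr h, covAlong_add (smoothAlongAt_covAlong hF hV hY).diffAlongAt
      (smoothAlongAt_covAlong hF hW hY).diffAlongAt]
  rw [curvatureAlong, key hX hY, key hY hX, covAlong_add hV.diffAlongAt hW.diffAlongAt,
    curvatureAlong, curvatureAlong]
  abel

lemma curvatureAlong_congr {W : ∀ y : M, TangentSpace (𝓡 n) (F y)}
    (h : ∀ᶠ y in 𝓝 x, V y = W y) :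
    curvatureAlong F X Y V x = curvatureAlong F X Y W x := by
  have h' (X : ∀ y : M, TangentSpace (𝓡 m) y) :
      ∀ᶠ y in 𝓝 x, covAlong F V y (X y) = covAlong F W y (X y) := by
    filter_upwards [eventually_eventually_nhds.2 h] with y hy
    exact covAlong_congr hy _
  rw [curvatureAlong, covAlong_congr (h' X), covAlong_congr (h' Y), covAlong_congr h,
    curvatureAlong]

lemma curvatureAlong_zero (hF : ContMDiff (𝓡 m) (𝓡 n) ∞ F)
    (hX : SmoothAlongAt m (fun y : M => y) X x)
    (hY : SmoothAlongAt m (fun y : M => y) Y x) :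
    curvatureAlong F X Y (fun y => (0 : TangentSpace (𝓡 n) (F y))) x = 0 := by
  have h := curvatureAlong_smul hF hX hY (f := fun _ => 0) contMDiffAt_const
    (smoothAlongAt_zero (n := n) hF.contMDiffAt)
  simpa using h

lemma curvatureAlong_sum (hF : ContMDiff (𝓡 m) (𝓡 n) ∞ F)
    (hX : SmoothAlongAt m (fun y : M => y) X x)
    (hY : SmoothAlongAt m (fun y : M => y) Y x) {ι : Type*} (s : Finset ι)
    {V : ι → ∀ y : M, TangentSpace (𝓡 n) (F y)} (hV : ∀ i, SmoothAlongAt m F (V i) x) :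
    curvatureAlong F X Y (fun y => ∑ i ∈ s, V i y) x = ∑ i ∈ s, curvatureAlong F X Y (V i) x := by
  classical
  induction s using Finset.induction_on with
  | empty => simpa using curvatureAlong_zero hF hX hY
  | insert a s ha ih =>
    simp only [Finset.sum_insert ha]
    rw [curvatureAlong_add hF hX hY (hV a)
      (SmoothAlongAt.sum s hF.contMDiffAt fun i _ => hV i), ih]

end Curvature

/-! ### Curvature along a map into a space of constant curvature. -/

section ConstantCurvature

variable {n : ℕ} {N : Type*} [TopologicalSpace N]
  [ChartedSpace (EuclideanSpace ℝ (Fin n)) N] [IsManifold (𝓡 n) ∞ N]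
  [RiemannianBundle (fun y : N => TangentSpace (𝓡 n) y)]
  [IsContMDiffRiemannianBundle (𝓡 n) ∞ (EuclideanSpace ℝ (Fin n))
      (fun y : N => TangentSpace (𝓡 n) y)]
  {m : ℕ} {M : Type*} [TopologicalSpace M]
  [ChartedSpace (EuclideanSpace ℝ (Fin m)) M] [IsManifold (𝓡 m) ∞ M]

variable {F : M → N} {x : M} {X Y : ∀ y : M, TangentSpace (𝓡 m) y}
  {V : ∀ y : M, TangentSpace (𝓡 n) (F y)}

open VectorField

/-- The derivatives of the coefficients of `dF Y` are kept apart from the double sum over the frame.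
In `curvatureAlong_comp` they cancel, leaving a combination of curvatures of frame fields. -/
lemma IsOrthonormalFrameAt.covAlong_mfderiv {E : Fin n → ∀ y : N, TangentSpace (𝓡 n) y}
    (hE : IsOrthonormalFrameAt E (F x)) (hF : ContMDiff (𝓡 m) (𝓡 n) ∞ F)
    (hY : SmoothAlongAt m (fun y : M => y) Y x) (v : TangentSpace (𝓡 m) x) :
    covAlong F (fun y => mfderiv (𝓡 m) (𝓡 n) F y (Y y)) x v = ∑ k,
      mvfderiv (𝓡 m) (fun y => (inner ℝ (E k (F y)) (mfderiv (𝓡 m) (𝓡 n) F y (Y y)) : ℝ)) x v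
        • E k (F x)
      + ∑ i, ∑ k, ((inner ℝ (E i (F x)) (mfderiv (𝓡 m) (𝓡 n) F x v) : ℝ)
          * (inner ℝ (E k (F x)) (mfderiv (𝓡 m) (𝓡 n) F x (Y x)) : ℝ))
          • leviCivita (E k) (F x) (E i (F x)) := by
  rw [hE.covAlong_eq (SmoothAlongAt.mfderiv hY hF).diffAlongAt, Finset.sum_add_distrib,
    Finset.sum_comm]
  congr 1
  refine Finset.sum_congr rfl fun k _ => ?_
  rw [leviCivita_expand hE.orthonormal.self_of_nhds, Finset.smul_sum]
  refine Finset.sum_congr rfl fun i _ => ?_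
  rw [smul_smul, mul_comm]

lemma IsOrthonormalFrameAt.covAlong_covAlong_comp {E : Fin n → ∀ y : N, TangentSpace (𝓡 n) y}
    (hE : IsOrthonormalFrameAt E (F x)) (hF : ContMDiff (𝓡 m) (𝓡 n) ∞ F)
    (hY : SmoothAlongAt m (fun y : M => y) Y x) {Z : ∀ y : N, TangentSpace (𝓡 n) y}
    (hZ : SmoothAlongAt n (fun y : N => y) Z (F x)) (v : TangentSpace (𝓡 m) x) :
    covAlong F (fun y => covAlong F (fun y => Z (F y)) y (Y y)) x v
      = leviCivita Z (F x) (∑ k, mvfderiv (𝓡 m) (fun y => (inner ℝ (E k (F y))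
          (mfderiv (𝓡 m) (𝓡 n) F y (Y y)) : ℝ)) x v • E k (F x))
      + ∑ i, ∑ k, ((inner ℝ (E i (F x)) (mfderiv (𝓡 m) (𝓡 n) F x v) : ℝ)
          * (inner ℝ (E k (F x)) (mfderiv (𝓡 m) (𝓡 n) F x (Y x)) : ℝ))
          • leviCivita (fun y => leviCivita Z y (E k y)) (F x) (E i (F x)) := by
  have hdY : SmoothAlongAt m F (fun y => mfderiv (𝓡 m) (𝓡 n) F y (Y y)) x :=
    SmoothAlongAt.mfderiv hY hF
  have hW (k) : SmoothAlongAt n (fun y : N => y) (fun y => leviCivita Z y (E k y)) (F x) :=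
    smoothAlongAt_leviCivita (hE.smooth.self_of_nhds k) hZ
  have hWF (k) : SmoothAlongAt m F (fun y => leviCivita Z (F y) (E k (F y))) x :=
    SmoothAlongAt.comp (Z := fun y => leviCivita Z y (E k y)) (hW k) hF.contMDiffAt
  have hb (k) := mdiff_of_contMDiffAt ((hE.smoothAlongAt hF.contMDiffAt k).inner hdY)
  have h : ∀ᶠ y in 𝓝 x, covAlong F (fun y => Z (F y)) y (Y y)
      = ∑ k, (inner ℝ (E k (F y)) (mfderiv (𝓡 m) (𝓡 n) F y (Y y)) : ℝ)
        • leviCivita Z (F y) (E k (F y)) := by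
    filter_upwards [hF.continuous.continuousAt.eventually hE.orthonormal,
      hF.continuous.continuousAt.eventually hZ.eventually_diffAlongAt] with y h1 h2
    rw [covAlong_comp h2 (hF.mdifferentiable (by simp) y), leviCivita_expand h1]
  have hF' : MDifferentiableAt (𝓡 m) (𝓡 n) F x := hF.mdifferentiable (by simp) x
  rw [covAlong_congr h, covAlong_sum _ hF' fun k _ => (hWF k).diffAlongAt.smul (hb k),
    leviCivita_sum_dir, Finset.sum_comm, ← Finset.sum_add_distrib]
  refine Finset.sum_congr rfl fun k _ => ?_
  rw [covAlong_smul (hb k) (hWF k).diffAlongAt, leviCivita_smul_dir,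
    covAlong_comp (Z := fun y => leviCivita Z y (E k y)) (hW k).diffAlongAt hF',
    leviCivita_expand hE.orthonormal.self_of_nhds (fun y => leviCivita Z y (E k y)),
    Finset.smul_sum]
  congr 1
  refine Finset.sum_congr rfl fun i _ => ?_
  rw [smul_smul, mul_comm]

/-- The curvature hypothesis concerns vector fields on `N`, and `dF X` need not be the restriction
of one. It is applied to the frame fields; vanishing torsion along `F` and in `N` accounts for the
bracket terms. -/
lemma curvatureAlong_comp {c : ℝ} (hN : HasConstantCurvature n N c)
    (hF : ContMDiff (𝓡 m) (𝓡 n) ∞ F) (hX : SmoothAlongAt m (fun y : M => y) X x)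
    (hY : SmoothAlongAt m (fun y : M => y) Y x) {Z : ∀ y : N, TangentSpace (𝓡 n) y}
    (hZ : SmoothAlongAt n (fun y : N => y) Z (F x)) :
    curvatureAlong F X Y (fun y => Z (F y)) x
      = c • ((inner ℝ (mfderiv (𝓡 m) (𝓡 n) F x (Y x)) (Z (F x)) : ℝ)
          • mfderiv (𝓡 m) (𝓡 n) F x (X x)
        - (inner ℝ (mfderiv (𝓡 m) (𝓡 n) F x (X x)) (Z (F x)) : ℝ)
          • mfderiv (𝓡 m) (𝓡 n) F x (Y x)) := by
  obtain ⟨E, hE⟩ := exists_isOrthonormalFrameAt (n := n) (F x)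
  have hF' : MDifferentiableAt (𝓡 m) (𝓡 n) F x := hF.mdifferentiable (by simp) x
  have ho := hE.orthonormal.self_of_nhds
  have hs := hE.smooth.self_of_nhds
  have ht := covAlong_mfderiv_sub hF.contMDiffAt hX.diffAlongAt hY.diffAlongAt
  rw [hE.covAlong_mfderiv hF hX, hE.covAlong_mfderiv hF hY] at ht
  rw [curvatureAlong, hE.covAlong_covAlong_comp hF hX hZ, hE.covAlong_covAlong_comp hF hY hZ,
    covAlong_comp hZ.diffAlongAt hF', ← ht]
  set a := fun i => (inner ℝ (E i (F x)) (mfderiv (𝓡 m) (𝓡 n) F x (X x)) : ℝ) with ha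
  set b := fun i => (inner ℝ (E i (F x)) (mfderiv (𝓡 m) (𝓡 n) F x (Y x)) : ℝ) with hb
  have hdX : mfderiv (𝓡 m) (𝓡 n) F x (X x) = ∑ i, a i • E i (F x) := (sum_inner_smul ho _).symm
  have hdY : mfderiv (𝓡 m) (𝓡 n) F x (Y x) = ∑ i, b i • E i (F x) := (sum_inner_smul ho _).symm
  have hR (i j : Fin n) := hN (F x) (E i) (E j) Z (hs i) (hs j) hZ
  have hbr (i j : Fin n) := leviCivita_sub (hs i).diffAlongAt (hs j).diffAlongAt
  let L : TangentSpace (𝓡 n) (F x) →ₗ[ℝ] TangentSpace (𝓡 n) (F x) :=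
    covAlongL (fun y : N => y) Z (F x)
  have hL (w) : leviCivita Z (F x) w = L w := rfl
  -- Relabels the sums produced by exchanging `X` and `Y`, so that all of them carry the
  -- coefficients `a i * b k`.
  have swap {T : Type _} [AddCommGroup T] [Module ℝ T] (G : Fin n → Fin n → T) :
      ∑ i, ∑ k, (b i * a k) • G i k = ∑ i, ∑ k, (a i * b k) • G k i := by
    rw [Finset.sum_comm]
    simp only [mul_comm]
  have hmain : ∑ i, ∑ k, (a i * b k) • curvature (E i) (E k) Z (F x)
      = c • ((inner ℝ (mfderiv (𝓡 m) (𝓡 n) F x (Y x)) (Z (F x)) : ℝ)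
          • mfderiv (𝓡 m) (𝓡 n) F x (X x)
        - (inner ℝ (mfderiv (𝓡 m) (𝓡 n) F x (X x)) (Z (F x)) : ℝ)
          • mfderiv (𝓡 m) (𝓡 n) F x (Y x)) := by
    simp only [hR, smul_sub, Finset.sum_sub_distrib]
    rw [hdX, hdY]
    simp only [sum_inner, real_inner_smul_left, Finset.sum_smul, Finset.smul_sum]
    congr 1
    · refine Finset.sum_congr rfl fun i _ => Finset.sum_congr rfl fun k _ => ?_
      module
    · rw [Finset.sum_comm]
      refine Finset.sum_congr rfl fun i _ => Finset.sum_congr rfl fun k _ => ?_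
      module
  rw [← hmain]
  simp only [curvature, smul_sub, Finset.sum_sub_distrib, ← hbr, hL, map_sub, map_add, map_sum,
    map_smul]
  rw [swap, swap]
  abel

/-- The curvature along a map into a space of constant curvature. -/
theorem curvatureAlong_eq {c : ℝ} (hN : HasConstantCurvature n N c)
    (hF : ContMDiff (𝓡 m) (𝓡 n) ∞ F) (hX : SmoothAlongAt m (fun y : M => y) X x)
    (hY : SmoothAlongAt m (fun y : M => y) Y x) (hV : SmoothAlongAt m F V x) :
    curvatureAlong F X Y V x
      = c • ((inner ℝ (mfderiv (𝓡 m) (𝓡 n) F x (Y x)) (V x) : ℝ)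
          • mfderiv (𝓡 m) (𝓡 n) F x (X x)
        - (inner ℝ (mfderiv (𝓡 m) (𝓡 n) F x (X x)) (V x) : ℝ)
          • mfderiv (𝓡 m) (𝓡 n) F x (Y x)) := by
  obtain ⟨E, hE⟩ := exists_isOrthonormalFrameAt (n := n) (F x)
  have hEk (k) := hE.smoothAlongAt (m := m) hF.contMDiffAt k
  have hVk (k) := (hEk k).inner hV
  have hVx := (sum_inner_smul hE.orthonormal.self_of_nhds (V x)).symm
  -- By tensoriality it suffices to treat the frame fields composed with `F`.
  rw [curvatureAlong_congr (hE.eventually_eq hF.continuous.continuousAt V),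
    curvatureAlong_sum hF hX hY _ fun k => SmoothAlongAt.smul (hVk k) (hEk k)]
  have h (k) := curvatureAlong_smul hF hX hY (hVk k) (hEk k)
  simp only [h, curvatureAlong_comp hN hF hX hY (hE.smooth.self_of_nhds _)]
  conv_rhs => rw [hVx]
  simp only [inner_sum, real_inner_smul_right, Finset.sum_smul, ← Finset.sum_sub_distrib,
    Finset.smul_sum]
  refine Finset.sum_congr rfl fun k _ => ?_
  module

end ConstantCurvature

/-! ### Second fundamental form, tension field and the formula for `S₂`. -/

section SecondFundamentalForm

variable {n : ℕ} {N : Type*} [TopologicalSpace N]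
  [ChartedSpace (EuclideanSpace ℝ (Fin n)) N] [IsManifold (𝓡 n) ∞ N]
  [RiemannianBundle (fun y : N => TangentSpace (𝓡 n) y)]
  [IsContMDiffRiemannianBundle (𝓡 n) ∞ (EuclideanSpace ℝ (Fin n))
      (fun y : N => TangentSpace (𝓡 n) y)]
  {m : ℕ} {M : Type*} [TopologicalSpace M]
  [ChartedSpace (EuclideanSpace ℝ (Fin m)) M] [IsManifold (𝓡 m) ∞ M]
  [RiemannianBundle (fun x : M => TangentSpace (𝓡 m) x)]
  [IsContMDiffRiemannianBundle (𝓡 m) ∞ (EuclideanSpace ℝ (Fin m))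
      (fun x : M => TangentSpace (𝓡 m) x)]

variable {φ : M → N} {x : M} {X Y : ∀ y : M, TangentSpace (𝓡 m) y}

open VectorField

lemma leviCivita_add (hX : DiffAlongAt m (fun y : M => y) X x)
    (hY : DiffAlongAt m (fun y : M => y) Y x) (v : TangentSpace (𝓡 m) x) :
    leviCivita (fun y => X y + Y y) x v = leviCivita X x v + leviCivita Y x v :=
  covAlong_add hX hY v

lemma leviCivita_smul {f : M → ℝ} (hf : MDifferentiableAt (𝓡 m) 𝓘(ℝ, ℝ) f x)
    (hX : DiffAlongAt m (fun y : M => y) X x) (v : TangentSpace (𝓡 m) x) :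
    leviCivita (fun y => f y • X y) x v
      = mvfderiv (𝓡 m) f x v • X x + f x • leviCivita X x v :=
  covAlong_smul hf hX v

lemma leviCivita_congr (h : ∀ᶠ y in 𝓝 x, X y = Y y) (v : TangentSpace (𝓡 m) x) :
    leviCivita X x v = leviCivita Y x v :=
  covAlong_congr (F := fun y : M => y) h v

/-- The second fundamental form, computed with an extension of the second vector. -/
def hessField (φ : M → N) (Y : ∀ y : M, TangentSpace (𝓡 m) y) (x : M) (v : TangentSpace (𝓡 m) x) :
    TangentSpace (𝓡 n) (φ x) :=
  covAlong φ (fun y => mfderiv (𝓡 m) (𝓡 n) φ y (Y y)) x v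
    - mfderiv (𝓡 m) (𝓡 n) φ x (leviCivita Y x v)

lemma hessField_add (hφ : ContMDiff (𝓡 m) (𝓡 n) ∞ φ) (hX : DiffAlongAt m (fun y : M => y) X x)
    (hY : DiffAlongAt m (fun y : M => y) Y x) (v : TangentSpace (𝓡 m) x) :
    hessField (n := n) φ (fun y => X y + Y y) x v
      = hessField (n := n) φ X x v + hessField (n := n) φ Y x v := by
  simp only [hessField, map_add]
  rw [covAlong_add (hX.mfderiv hφ) (hY.mfderiv hφ), leviCivita_add hX hY, map_add]
  abel

lemma hessField_smul (hφ : ContMDiff (𝓡 m) (𝓡 n) ∞ φ) {f : M → ℝ}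
    (hf : MDifferentiableAt (𝓡 m) 𝓘(ℝ, ℝ) f x) (hX : DiffAlongAt m (fun y : M => y) X x)
    (v : TangentSpace (𝓡 m) x) :
    hessField (n := n) φ (fun y => f y • X y) x v = f x • hessField (n := n) φ X x v := by
  simp only [hessField, map_smul]
  rw [covAlong_smul hf (hX.mfderiv hφ), leviCivita_smul hf hX, map_add, map_smul, map_smul]
  module

lemma hessField_congr (h : ∀ᶠ y in 𝓝 x, X y = Y y) (v : TangentSpace (𝓡 m) x) :
    hessField (n := n) φ X x v = hessField (n := n) φ Y x v := by
  rw [hessField, hessField, leviCivita_congr h, covAlong_congr]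
  filter_upwards [h] with y hy
  rw [hy]

/-- The second fundamental form does not depend on the extension. -/
theorem hessField_eq (hφ : ContMDiff (𝓡 m) (𝓡 n) ∞ φ) (hY : DiffAlongAt m (fun y : M => y) Y x)
    (v : TangentSpace (𝓡 m) x) :
    hessField φ Y x v = secondFundamentalForm m n φ x v (Y x) := by
  have hdef (w) : secondFundamentalForm m n φ x v w = hessField φ (coordField x w) x v := rfl
  rw [hdef]
  refine DiffAlongAt.induction (F := fun y : M => y)
    (P := fun Y => hessField φ Y x v = hessField φ (coordField x (Y x)) x v) hY
    (fun u => ?_) (fun V W hV hW h h' => ?_) (fun f V hf hV h => ?_) (fun V W hV h h' => ?_)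
  · simp only [coordField_self]
  · rw [hessField_add hφ hV hW, h, h', ← hessField_add hφ (diffAlongAt_coordField _ _)
      (diffAlongAt_coordField _ _)]
    refine hessField_congr ?_ v
    filter_upwards [coordField_add x (V x) (W x)] with y hy
    exact hy.symm
  · rw [hessField_smul hφ hf hV, h, ← hessField_smul hφ (f := fun _ => f x)
      mdifferentiableAt_const (diffAlongAt_coordField _ _)]
    refine hessField_congr ?_ v
    filter_upwards [coordField_smul x (f x) (V x)] with y hy
    exact hy.symm
  · rw [hessField_congr h', h, h'.self_of_nhds]

/-- Gauss' formula. -/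
lemma covAlong_mfderiv_eq (hφ : ContMDiff (𝓡 m) (𝓡 n) ∞ φ)
    (hY : DiffAlongAt m (fun y : M => y) Y x) (v : TangentSpace (𝓡 m) x) :
    covAlong φ (fun y => mfderiv (𝓡 m) (𝓡 n) φ y (Y y)) x v
      = mfderiv (𝓡 m) (𝓡 n) φ x (leviCivita Y x v) + secondFundamentalForm m n φ x v (Y x) := by
  rw [← hessField_eq hφ hY, hessField]
  abel

lemma secondFundamentalForm_add_right (hφ : ContMDiff (𝓡 m) (𝓡 n) ∞ φ)
    (v w w' : TangentSpace (𝓡 m) x) :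
    secondFundamentalForm m n φ x v (w + w')
      = secondFundamentalForm m n φ x v w + secondFundamentalForm m n φ x v w' := by
  have h := hessField_add hφ (diffAlongAt_coordField x w) (diffAlongAt_coordField x w') v
  rw [hessField_eq hφ ((diffAlongAt_coordField x w).add (diffAlongAt_coordField x w')),
    hessField_eq hφ (diffAlongAt_coordField x w),
    hessField_eq hφ (diffAlongAt_coordField x w')] at h
  simpa only [coordField_self] using h

lemma secondFundamentalForm_smul_right (hφ : ContMDiff (𝓡 m) (𝓡 n) ∞ φ) (r : ℝ)
    (v w : TangentSpace (𝓡 m) x) :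
    secondFundamentalForm m n φ x v (r • w) = r • secondFundamentalForm m n φ x v w := by
  have h := hessField_smul hφ (f := fun _ => r) mdifferentiableAt_const
    (diffAlongAt_coordField x w) v
  rw [hessField_eq hφ (DiffAlongAt.smul mdifferentiableAt_const (diffAlongAt_coordField x w)),
    hessField_eq hφ (diffAlongAt_coordField x w)] at h
  simpa only [coordField_self] using h

/-- Torsion vanishes both on `M` and along `φ`: the antisymmetric parts of `∇^φ(dφ ·)` and of `dφ(∇
·)` are both `dφ` of the bracket, and they cancel. -/
lemma secondFundamentalForm_symm (hφ : ContMDiff (𝓡 m) (𝓡 n) ∞ φ) (v w : TangentSpace (𝓡 m) x) :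
    secondFundamentalForm m n φ x v w = secondFundamentalForm m n φ x w v := by
  have hv := diffAlongAt_coordField x v
  have hw := diffAlongAt_coordField x w
  have h1 := covAlong_mfderiv_sub hφ.contMDiffAt hv hw
  have h2 := leviCivita_sub hv hw
  rw [← h2, map_sub, covAlong_mfderiv_eq hφ hv, covAlong_mfderiv_eq hφ hw] at h1
  simp only [coordField_self] at h1
  rw [add_sub_add_comm, add_eq_left, sub_eq_zero] at h1
  exact h1

/-- The second fundamental form as a bilinear map. -/
def secondFundamentalFormL (hφ : ContMDiff (𝓡 m) (𝓡 n) ∞ φ) (x : M) :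
    TangentSpace (𝓡 m) x →ₗ[ℝ] TangentSpace (𝓡 m) x →ₗ[ℝ] TangentSpace (𝓡 n) (φ x) :=
  LinearMap.mk₂ ℝ (secondFundamentalForm m n φ x)
    (fun v v' w => by
      simp only [secondFundamentalForm_symm hφ _ w, secondFundamentalForm_add_right hφ])
    (fun r v w => by
      simp only [secondFundamentalForm_symm hφ _ w, secondFundamentalForm_smul_right hφ])
    (secondFundamentalForm_add_right hφ) (secondFundamentalForm_smul_right hφ)

/-- The second fundamental form is normal. -/
lemma inner_secondFundamentalForm (hφ : IsIsometricImmersion m n φ)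
    (v w u : TangentSpace (𝓡 m) x) :
    (inner ℝ (secondFundamentalForm m n φ x v w) (mfderiv (𝓡 m) (𝓡 n) φ x u) : ℝ) = 0 := by
  rw [secondFundamentalForm, inner_sub_left,
    inner_covAlong_mfderiv hφ (diffAlongAt_coordField x w), hφ.isometric, sub_self]

lemma inner_tension (hφ : IsIsometricImmersion m n φ) (u : TangentSpace (𝓡 m) x) :
    (inner ℝ (tension m n φ x) (mfderiv (𝓡 m) (𝓡 n) φ x u) : ℝ) = 0 := by
  rw [tension, sum_inner]
  exact Finset.sum_eq_zero fun i _ => inner_secondFundamentalForm hφ _ _ _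

/-- The trace of a bilinear map does not depend on the orthonormal basis. -/
lemma sum_orthonormal_eq {T : Type*} [AddCommGroup T] [Module ℝ T]
    (B : TangentSpace (𝓡 m) x →ₗ[ℝ] TangentSpace (𝓡 m) x →ₗ[ℝ] T)
    {e : Fin m → TangentSpace (𝓡 m) x} (he : Orthonormal ℝ e) :
    ∑ i, B (frame x i) (frame x i) = ∑ k, B (e k) (e k) := by
  have h (i) : B (frame x i) (frame x i)
      = ∑ k, ∑ l, ((inner ℝ (e k) (frame x i) : ℝ) * (inner ℝ (frame x i) (e l) : ℝ))
        • B (e k) (e l) := by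
    conv_lhs => rw [← sum_inner_smul he (frame x i)]
    simp only [map_sum, map_smul, LinearMap.sum_apply, LinearMap.smul_apply, Finset.smul_sum,
      smul_smul, real_inner_comm]
    rw [Finset.sum_comm]
    simp only [mul_comm]
  simp only [h]
  rw [Finset.sum_comm]
  refine Finset.sum_congr rfl fun k _ => ?_
  rw [Finset.sum_comm]
  simp only [← Finset.sum_smul, (frame x).sum_inner_mul_inner]
  classical
  simp [orthonormal_iff_ite.1 he]

lemma tension_eq_sum (hφ : ContMDiff (𝓡 m) (𝓡 n) ∞ φ) {e : Fin m → TangentSpace (𝓡 m) x}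
    (he : Orthonormal ℝ e) :
    tension m n φ x = ∑ k, secondFundamentalForm m n φ x (e k) (e k) :=
  sum_orthonormal_eq (secondFundamentalFormL hφ x) he

lemma smoothAlongAt_secondFundamentalForm (hφ : ContMDiff (𝓡 m) (𝓡 n) ∞ φ)
    (hX : SmoothAlongAt m (fun y : M => y) X x) (hY : SmoothAlongAt m (fun y : M => y) Y x) :
    SmoothAlongAt m φ (fun y => secondFundamentalForm m n φ y (X y) (Y y)) x := by
  refine ((smoothAlongAt_covAlong hφ (SmoothAlongAt.mfderiv hY hφ) hX).sub
    (SmoothAlongAt.mfderiv (smoothAlongAt_leviCivita hX hY) hφ)).congr ?_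
  filter_upwards [hY.eventually_diffAlongAt] with y hy
  exact (hessField_eq hφ hy _).symm

/-- The tension field is smooth. -/
theorem smoothAlongAt_tension (hφ : ContMDiff (𝓡 m) (𝓡 n) ∞ φ) (x : M) :
    SmoothAlongAt m φ (tension m n φ) x := by
  -- The bases `frame y` are chosen point by point without regularity. Since the trace does not
  -- depend on the basis, a smooth frame may replace them.
  obtain ⟨E, hE⟩ := exists_isOrthonormalFrameAt (n := m) x
  have hs := hE.smooth.self_of_nhds
  refine (SmoothAlongAt.sum (F := φ) Finset.univ hφ.contMDiffAt fun k _ =>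
    smoothAlongAt_secondFundamentalForm hφ (hs k) (hs k)).congr ?_
  filter_upwards [hE.orthonormal] with y hy
  exact tension_eq_sum hφ hy

/-- Weingarten's formula. -/
lemma inner_mfderiv_covAlong (hφ : IsIsometricImmersion m n φ)
    {ξ : ∀ y : M, TangentSpace (𝓡 n) (φ y)} (hξ : DiffAlongAt m φ ξ x)
    (hn : ∀ᶠ y in 𝓝 x, ∀ v : TangentSpace (𝓡 m) y,
      (inner ℝ (mfderiv (𝓡 m) (𝓡 n) φ y v) (ξ y) : ℝ) = 0) (v w : TangentSpace (𝓡 m) x) :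
    (inner ℝ (mfderiv (𝓡 m) (𝓡 n) φ x w) (covAlong φ ξ x v) : ℝ)
      = -inner ℝ (secondFundamentalForm m n φ x v w) (ξ x) := by
  have hw := diffAlongAt_coordField x w
  have h := mvfderiv_inner (hw.mfderiv hφ.smooth) hξ v
  have h0 : (fun y => (inner ℝ (mfderiv (𝓡 m) (𝓡 n) φ y (coordField x w y)) (ξ y) : ℝ))
      =ᶠ[𝓝 x] fun _ => 0 := by
    filter_upwards [hn] with y hy
    exact hy _
  rw [mvfderiv_congr h0, mvfderiv_const, covAlong_mfderiv_eq hφ.smooth hw, inner_add_left,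
    hn.self_of_nhds, coordField_self] at h
  simp only [zero_apply] at h
  linarith

/-- The stress-energy tensor of an isometric immersion. -/
theorem stressEnergy₂_eq (hφ : IsIsometricImmersion m n φ) (x : M) (v w : TangentSpace (𝓡 m) x) :
    stressEnergy₂ m n φ x v w = -(‖tension m n φ x‖ ^ 2 / 2) * inner ℝ v w
      + 2 * inner ℝ (secondFundamentalForm m n φ x v w) (tension m n φ x) := by
  have hτ := (smoothAlongAt_tension hφ.smooth x).diffAlongAt
  have hn : ∀ᶠ y in 𝓝 x, ∀ v : TangentSpace (𝓡 m) y,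
      (inner ℝ (mfderiv (𝓡 m) (𝓡 n) φ y v) (tension m n φ y) : ℝ) = 0 :=
    Filter.Eventually.of_forall fun y v => by rw [real_inner_comm, inner_tension hφ]
  -- The trace of Weingarten's formula for `ξ = τ`. It changes the coefficient of the metric from
  -- `|τ|²/2` to `-|τ|²/2`.
  have hs : ∑ i, (inner ℝ (mfderiv (𝓡 m) (𝓡 n) φ x (frame x i))
      (covAlong φ (tension m n φ) x (frame x i)) : ℝ) = -‖tension m n φ x‖ ^ 2 := by
    simp only [inner_mfderiv_covAlong hφ hτ hn, Finset.sum_neg_distrib, ← sum_inner]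
    rw [← real_inner_self_eq_norm_sq]
    rfl
  rw [stressEnergy₂, hs, inner_mfderiv_covAlong hφ hτ hn, inner_mfderiv_covAlong hφ hτ hn,
    secondFundamentalForm_symm hφ.smooth w v]
  ring

end SecondFundamentalForm

/-! ### The shape operator of a unit normal field. -/

section ShapeOperator

variable {n : ℕ} {N : Type*} [TopologicalSpace N]
  [ChartedSpace (EuclideanSpace ℝ (Fin n)) N] [IsManifold (𝓡 n) ∞ N]
  [RiemannianBundle (fun y : N => TangentSpace (𝓡 n) y)]
  [IsContMDiffRiemannianBundle (𝓡 n) ∞ (EuclideanSpace ℝ (Fin n))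
      (fun y : N => TangentSpace (𝓡 n) y)]
  {m : ℕ} {M : Type*} [TopologicalSpace M]
  [ChartedSpace (EuclideanSpace ℝ (Fin m)) M] [IsManifold (𝓡 m) ∞ M]
  [RiemannianBundle (fun x : M => TangentSpace (𝓡 m) x)]
  [IsContMDiffRiemannianBundle (𝓡 m) ∞ (EuclideanSpace ℝ (Fin m))
      (fun x : M => TangentSpace (𝓡 m) x)]

variable {φ : M → N} {x : M} {X Y : ∀ y : M, TangentSpace (𝓡 m) y}
  {η : ∀ y : M, TangentSpace (𝓡 n) (φ y)} {U : Set M}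

open VectorField

lemma shapeOperator_add (v w : TangentSpace (𝓡 m) x) :
    shapeOperator m n φ η x (v + w) = shapeOperator m n φ η x v + shapeOperator m n φ η x w := by
  simp only [shapeOperator, covAlong_add_dir, inner_add_left, add_smul, Finset.sum_add_distrib,
    neg_add]

lemma shapeOperator_smul (r : ℝ) (v : TangentSpace (𝓡 m) x) :
    shapeOperator m n φ η x (r • v) = r • shapeOperator m n φ η x v := by
  simp only [shapeOperator, covAlong_smul_dir, real_inner_smul_left, mul_smul, Finset.smul_sum,
    smul_neg]

lemma shapeOperator_sub (v w : TangentSpace (𝓡 m) x) :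
    shapeOperator m n φ η x (v - w) = shapeOperator m n φ η x v - shapeOperator m n φ η x w := by
  rw [sub_eq_add_neg, ← neg_one_smul ℝ w, shapeOperator_add, shapeOperator_smul]
  module

lemma inner_shapeOperator (v w : TangentSpace (𝓡 m) x) :
    (inner ℝ (shapeOperator m n φ η x v) w : ℝ)
      = -inner ℝ (covAlong φ η x v) (mfderiv (𝓡 m) (𝓡 n) φ x w) := by
  conv_rhs => rw [← (frame x).sum_repr' w]
  simp only [shapeOperator, inner_neg_left, sum_inner, map_sum, map_smul, inner_sum,
    real_inner_smul_left, real_inner_smul_right, mul_comm]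

lemma IsUnitNormalOn.smoothAlongAt (hη : IsUnitNormalOn m n φ η U) (hU : IsOpen U) (hx : x ∈ U) :
    SmoothAlongAt m φ η x :=
  hη.smooth.contMDiffAt (hU.mem_nhds hx)

lemma IsUnitNormalOn.inner_shapeOperator (hη : IsUnitNormalOn m n φ η U)
    (hφ : IsIsometricImmersion m n φ) (hU : IsOpen U) (hx : x ∈ U) (v w : TangentSpace (𝓡 m) x) :
    (inner ℝ (shapeOperator m n φ η x v) w : ℝ)
      = inner ℝ (secondFundamentalForm m n φ x v w) (η x) := by
  rw [RiemannianHypersurface.inner_shapeOperator, real_inner_comm,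
    inner_mfderiv_covAlong hφ (hη.smoothAlongAt hU hx).diffAlongAt, neg_neg]
  filter_upwards [hU.mem_nhds hx] with y hy
  exact hη.normal y hy

lemma IsUnitNormalOn.shapeOperator_symm (hη : IsUnitNormalOn m n φ η U)
    (hφ : IsIsometricImmersion m n φ) (hU : IsOpen U) (hx : x ∈ U) (v w : TangentSpace (𝓡 m) x) :
    (inner ℝ (shapeOperator m n φ η x v) w : ℝ) = inner ℝ v (shapeOperator m n φ η x w) := by
  rw [real_inner_comm (shapeOperator m n φ η x w), hη.inner_shapeOperator hφ hU hx,
    hη.inner_shapeOperator hφ hU hx, secondFundamentalForm_symm hφ.smooth]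

/-- The shape operator maps smooth fields to smooth fields. -/
lemma IsUnitNormalOn.smoothAlongAt_shapeOperator (hη : IsUnitNormalOn m n φ η U)
    (hφ : IsIsometricImmersion m n φ) (hU : IsOpen U) (hx : x ∈ U)
    (hY : SmoothAlongAt m (fun y : M => y) Y x) :
    SmoothAlongAt m (fun y : M => y) (fun y => shapeOperator m n φ η y (Y y)) x := by
  obtain ⟨E, hE⟩ := exists_isOrthonormalFrameAt (n := m) x
  have hs := hE.smooth.self_of_nhds
  refine (SmoothAlongAt.sum (F := fun y : M => y) (n := m)
    (V := fun k y => -(inner ℝ (covAlong φ η y (Y y)) (mfderiv (𝓡 m) (𝓡 n) φ y (E k y)) : ℝ)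
      • E k y) Finset.univ contMDiffAt_id fun k _ =>
    SmoothAlongAt.smul (SmoothAlongAt.inner (smoothAlongAt_covAlong hφ.smooth
      (hη.smoothAlongAt hU hx) hY) (SmoothAlongAt.mfderiv (hs k) hφ.smooth)).neg (hs k)).congr ?_
  filter_upwards [hE.orthonormal] with y hy
  rw [← sum_inner_smul hy (shapeOperator m n φ η y (Y y))]
  refine Finset.sum_congr rfl fun k _ => ?_
  rw [real_inner_comm, RiemannianHypersurface.inner_shapeOperator]

lemma IsIsometricImmersion.mfderiv_injective (hφ : IsIsometricImmersion m n φ)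
    {u v : TangentSpace (𝓡 m) x}
    (h : mfderiv (𝓡 m) (𝓡 n) φ x u = mfderiv (𝓡 m) (𝓡 n) φ x v) : u = v := by
  rw [← sub_eq_zero, ← map_sub] at h
  rw [← sub_eq_zero, ← inner_self_eq_zero (𝕜 := ℝ), ← hφ.isometric, h, inner_zero_left]

end ShapeOperator

/-! ### Hypersurfaces: Codazzi equation, `∇S₂`, and derivatives of `tr A` and `|A|²`. -/

section Hypersurface

variable {m : ℕ} {N : Type*} [TopologicalSpace N]
  [ChartedSpace (EuclideanSpace ℝ (Fin (m + 1))) N] [IsManifold (𝓡 (m + 1)) ∞ N]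
  [RiemannianBundle (fun y : N => TangentSpace (𝓡 (m + 1)) y)]
  [IsContMDiffRiemannianBundle (𝓡 (m + 1)) ∞ (EuclideanSpace ℝ (Fin (m + 1)))
      (fun y : N => TangentSpace (𝓡 (m + 1)) y)]
  {M : Type*} [TopologicalSpace M]
  [ChartedSpace (EuclideanSpace ℝ (Fin m)) M] [IsManifold (𝓡 m) ∞ M]
  [RiemannianBundle (fun x : M => TangentSpace (𝓡 m) x)]
  [IsContMDiffRiemannianBundle (𝓡 m) ∞ (EuclideanSpace ℝ (Fin m))
      (fun x : M => TangentSpace (𝓡 m) x)]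

variable {φ : M → N} {x : M} {X Y Z : ∀ y : M, TangentSpace (𝓡 m) y}
  {η : ∀ y : M, TangentSpace (𝓡 (m + 1)) (φ y)} {U : Set M}

open VectorField

/-- The normal space of a hypersurface is a line. -/
lemma IsUnitNormalOn.eq_smul (hη : IsUnitNormalOn m (m + 1) φ η U)
    (hφ : IsIsometricImmersion m (m + 1) φ) (hx : x ∈ U) {ξ : TangentSpace (𝓡 (m + 1)) (φ x)}
    (hξ : ∀ v : TangentSpace (𝓡 m) x,
      (inner ℝ (mfderiv (𝓡 m) (𝓡 (m + 1)) φ x v) ξ : ℝ) = 0) :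
    (inner ℝ (η x) ξ : ℝ) • η x = ξ := by
  obtain ⟨E, hE⟩ := exists_isOrthonormalFrameAt (n := m) x
  have he := orthonormal_iff_ite.1 hE.orthonormal.self_of_nhds
  -- Codimension one enters here: `η` and the images of an orthonormal basis are `m + 1` orthonormal
  -- vectors, so they span the tangent space of `N`.
  let g : Fin (m + 1) → TangentSpace (𝓡 (m + 1)) (φ x) :=
    Fin.cons (η x) fun k => mfderiv (𝓡 m) (𝓡 (m + 1)) φ x (E k x)
  have hg : Orthonormal ℝ g := by
    rw [orthonormal_iff_ite]
    refine Fin.cases (Fin.cases ?_ fun j => ?_) fun i => Fin.cases ?_ fun j => ?_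
    · simp [g, hη.unit x hx]
    · simp only [g, Fin.cons_zero, Fin.cons_succ]
      rw [real_inner_comm, hη.normal x hx, if_neg (Fin.succ_ne_zero j).symm]
    · simp only [g, Fin.cons_zero, Fin.cons_succ]
      rw [hη.normal x hx, if_neg (Fin.succ_ne_zero i)]
    · simp only [g, Fin.cons_succ, Fin.succ_inj]
      rw [hφ.isometric, he]
  have h := sum_inner_smul hg ξ
  rw [Fin.sum_univ_succ] at h
  simpa [g, hξ] using h

lemma IsUnitNormalOn.secondFundamentalForm_eq (hη : IsUnitNormalOn m (m + 1) φ η U)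
    (hφ : IsIsometricImmersion m (m + 1) φ) (hU : IsOpen U) (hx : x ∈ U)
    (v w : TangentSpace (𝓡 m) x) :
    secondFundamentalForm m (m + 1) φ x v w
      = (inner ℝ (shapeOperator m (m + 1) φ η x v) w : ℝ) • η x := by
  rw [hη.inner_shapeOperator hφ hU hx, real_inner_comm]
  refine (hη.eq_smul hφ hx fun u => ?_).symm
  rw [real_inner_comm, inner_secondFundamentalForm hφ]

/-- In codimension one the derivative of `η` has no normal part, because `|η| = 1` forces `⟨η, ∇η⟩ =
0`. -/
lemma IsUnitNormalOn.covAlong_eq (hη : IsUnitNormalOn m (m + 1) φ η U)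
    (hφ : IsIsometricImmersion m (m + 1) φ) (hU : IsOpen U) (hx : x ∈ U)
    (v : TangentSpace (𝓡 m) x) :
    covAlong φ η x v = -mfderiv (𝓡 m) (𝓡 (m + 1)) φ x (shapeOperator m (m + 1) φ η x v) := by
  have hd := (hη.smoothAlongAt hU hx).diffAlongAt
  have h1 : (inner ℝ (η x) (covAlong φ η x v) : ℝ) = 0 := by
    have h := mvfderiv_inner hd hd v
    have h0 : (fun y => (inner ℝ (η y) (η y) : ℝ)) =ᶠ[𝓝 x] fun _ => 1 := by
      filter_upwards [hU.mem_nhds hx] with y hy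
      rw [real_inner_self_eq_norm_sq, hη.unit y hy, one_pow]
    rw [mvfderiv_congr h0, mvfderiv_const, real_inner_comm] at h
    simp only [zero_apply] at h
    linarith
  rw [← add_eq_zero_iff_eq_neg]
  rw [← hη.eq_smul hφ hx (ξ := covAlong φ η x v + _) fun u => ?_, inner_add_right, h1,
    real_inner_comm, hη.normal x hx, add_zero, zero_smul]
  rw [inner_add_right, hφ.isometric, real_inner_comm, real_inner_comm _ u,
    RiemannianHypersurface.inner_shapeOperator]
  ring

/-- The mean curvature function, up to the factor `m`. -/
def normalTension (φ : M → N) (η : ∀ y : M, TangentSpace (𝓡 (m + 1)) (φ y)) (x : M) : ℝ :=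
  inner ℝ (η x) (tension m (m + 1) φ x)

lemma IsUnitNormalOn.tension_eq (hη : IsUnitNormalOn m (m + 1) φ η U)
    (hφ : IsIsometricImmersion m (m + 1) φ) (hx : x ∈ U) :
    tension m (m + 1) φ x = normalTension φ η x • η x :=
  (hη.eq_smul hφ hx fun u => by rw [real_inner_comm, inner_tension hφ]).symm

lemma IsUnitNormalOn.norm_tension_sq (hη : IsUnitNormalOn m (m + 1) φ η U)
    (hφ : IsIsometricImmersion m (m + 1) φ) (hx : x ∈ U) :
    ‖tension m (m + 1) φ x‖ ^ 2 = normalTension φ η x ^ 2 := by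
  rw [hη.tension_eq hφ hx, norm_smul, hη.unit x hx, mul_one, Real.norm_eq_abs, sq_abs]

lemma IsUnitNormalOn.contMDiffAt_normalTension (hη : IsUnitNormalOn m (m + 1) φ η U)
    (hφ : IsIsometricImmersion m (m + 1) φ) (hU : IsOpen U) (hx : x ∈ U) :
    ContMDiffAt (𝓡 m) 𝓘(ℝ, ℝ) ∞ (normalTension φ η) x :=
  SmoothAlongAt.inner (hη.smoothAlongAt hU hx) (smoothAlongAt_tension hφ.smooth x)

lemma IsUnitNormalOn.normalTension_eq_sum (hη : IsUnitNormalOn m (m + 1) φ η U)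
    (hφ : IsIsometricImmersion m (m + 1) φ) (hU : IsOpen U) (hx : x ∈ U)
    {e : Fin m → TangentSpace (𝓡 m) x} (he : Orthonormal ℝ e) :
    normalTension φ η x = ∑ k, (inner ℝ (shapeOperator m (m + 1) φ η x (e k)) (e k) : ℝ) := by
  rw [normalTension, tension_eq_sum hφ.smooth he, inner_sum]
  refine Finset.sum_congr rfl fun k _ => ?_
  rw [hη.inner_shapeOperator hφ hU hx, real_inner_comm]

lemma IsUnitNormalOn.stressEnergy₂_eq (hη : IsUnitNormalOn m (m + 1) φ η U)
    (hφ : IsIsometricImmersion m (m + 1) φ) (hU : IsOpen U) (hx : x ∈ U)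
    (v w : TangentSpace (𝓡 m) x) :
    stressEnergy₂ m (m + 1) φ x v w
      = -(normalTension φ η x * normalTension φ η x) / 2 * inner ℝ v w
      + 2 * normalTension φ η x * inner ℝ (shapeOperator m (m + 1) φ η x v) w := by
  rw [RiemannianHypersurface.stressEnergy₂_eq hφ, hη.norm_tension_sq hφ hx,
    hη.inner_shapeOperator hφ hU hx]
  rw [hη.tension_eq hφ hx, real_inner_smul_right]
  ring

/-- The Codazzi equation in a space of constant curvature. -/
theorem IsUnitNormalOn.codazzi {c : ℝ} (hN : HasConstantCurvature (m + 1) N c)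
    (hη : IsUnitNormalOn m (m + 1) φ η U)
    (hφ : IsIsometricImmersion m (m + 1) φ) (hU : IsOpen U) (hx : x ∈ U)
    (hX : SmoothAlongAt m (fun y : M => y) X x) (hY : SmoothAlongAt m (fun y : M => y) Y x) :
    nablaEnd (shapeOperator m (m + 1) φ η) x (X x) Y
      = nablaEnd (shapeOperator m (m + 1) φ η) x (Y x) X := by
  have hs := hη.smoothAlongAt hU hx
  have h := curvatureAlong_eq hN hφ.smooth hX hY hs
  -- Constant curvature enters here: applied to a normal vector, the curvature formula contains only
  -- products of `η` with tangent vectors, so it gives zero.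
  rw [hη.normal x hx, hη.normal x hx, zero_smul, zero_smul, sub_zero, smul_zero] at h
  -- `∇_X ∇_Y η = -dφ(∇_X(AY)) - ⟨AX, AY⟩ η`. The normal part is symmetric in `X` and `Y` and drops
  -- out of the curvature.
  have key {X Y : ∀ y : M, TangentSpace (𝓡 m) y} (hY : SmoothAlongAt m (fun y : M => y) Y x) :
      covAlong φ (fun y => covAlong φ η y (Y y)) x (X x)
        = -(mfderiv (𝓡 m) (𝓡 (m + 1)) φ x
              (leviCivita (fun y => shapeOperator m (m + 1) φ η y (Y y)) x (X x))
            + (inner ℝ (shapeOperator m (m + 1) φ η x (X x))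
              (shapeOperator m (m + 1) φ η x (Y x)) : ℝ) • η x) := by
    have hA := hη.smoothAlongAt_shapeOperator hφ hU hx hY
    rw [covAlong_congr (W := fun y => -mfderiv (𝓡 m) (𝓡 (m + 1)) φ y
        (shapeOperator m (m + 1) φ η y (Y y))),
      covAlong_neg (SmoothAlongAt.mfderiv hA hφ.smooth).diffAlongAt,
      covAlong_mfderiv_eq hφ.smooth hA.diffAlongAt, hη.secondFundamentalForm_eq hφ hU hx]
    filter_upwards [hU.mem_nhds hx] with y hy
    exact hη.covAlong_eq hφ hU hy _
  rw [curvatureAlong, key hY, key hX, hη.covAlong_eq hφ hU hx,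
    real_inner_comm (shapeOperator m (m + 1) φ η x (X x))] at h
  rw [nablaEnd, nablaEnd, sub_eq_sub_iff_sub_eq_sub, ← shapeOperator_sub,
    leviCivita_sub hX.diffAlongAt hY.diffAlongAt]
  refine hφ.mfderiv_injective ?_
  rw [map_sub]
  rw [← sub_eq_zero, ← neg_eq_zero, ← h]
  abel

lemma mvfderiv_mul_apply {f g : M → ℝ} (hf : MDifferentiableAt (𝓡 m) 𝓘(ℝ, ℝ) f x)
    (hg : MDifferentiableAt (𝓡 m) 𝓘(ℝ, ℝ) g x) (v : TangentSpace (𝓡 m) x) :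
    mvfderiv (𝓡 m) (fun y => f y * g y) x v
      = f x * mvfderiv (𝓡 m) g x v + g x * mvfderiv (𝓡 m) f x v := by
  have h := congrArg (fun L => L v) (mvfderiv_mul hf hg)
  rw [show (fun y => f y * g y) = f * g from rfl]
  simpa using h

lemma mvfderiv_add_apply {f g : M → ℝ} (hf : MDifferentiableAt (𝓡 m) 𝓘(ℝ, ℝ) f x)
    (hg : MDifferentiableAt (𝓡 m) 𝓘(ℝ, ℝ) g x) (v : TangentSpace (𝓡 m) x) :
    mvfderiv (𝓡 m) (fun y => f y + g y) x v = mvfderiv (𝓡 m) f x v + mvfderiv (𝓡 m) g x v := by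
  have h := congrArg (fun L => L v) (mvfderiv_add hf hg)
  rw [show (fun y => f y + g y) = f + g from rfl]
  simpa using h

lemma mvfderiv_sum_apply {ι : Type*} (s : Finset ι) {f : ι → M → ℝ}
    (hf : ∀ i, MDifferentiableAt (𝓡 m) 𝓘(ℝ, ℝ) (f i) x) (v : TangentSpace (𝓡 m) x) :
    MDifferentiableAt (𝓡 m) 𝓘(ℝ, ℝ) (fun y => ∑ i ∈ s, f i y) x ∧
    mvfderiv (𝓡 m) (fun y => ∑ i ∈ s, f i y) x v = ∑ i ∈ s, mvfderiv (𝓡 m) (f i) x v := by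
  classical
  induction s using Finset.induction_on with
  | empty => simp [mvfderiv_const, mdifferentiableAt_const]
  | insert a s ha ih =>
    simp only [Finset.sum_insert ha]
    exact ⟨(hf a).add ih.1, by rw [mvfderiv_add_apply (hf a) ih.1, ih.2]⟩

lemma mvfderiv_inner_field (hX : DiffAlongAt m (fun y : M => y) X x)
    (hY : DiffAlongAt m (fun y : M => y) Y x) (v : TangentSpace (𝓡 m) x) :
    mvfderiv (𝓡 m) (fun y => (inner ℝ (X y) (Y y) : ℝ)) x v
      = inner ℝ (leviCivita X x v) (Y x) + inner ℝ (X x) (leviCivita Y x v) :=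
  mvfderiv_inner hX hY v

/-- The covariant derivative of the stress-energy tensor of a hypersurface. -/
theorem IsUnitNormalOn.nablaBilin_stressEnergy₂ (hη : IsUnitNormalOn m (m + 1) φ η U)
    (hφ : IsIsometricImmersion m (m + 1) φ) (hU : IsOpen U) (hx : x ∈ U)
    (hY : SmoothAlongAt m (fun y : M => y) Y x) (hZ : SmoothAlongAt m (fun y : M => y) Z x)
    (v : TangentSpace (𝓡 m) x) :
    nablaBilin (stressEnergy₂ m (m + 1) φ) x v Y Z
      = mvfderiv (𝓡 m) (normalTension φ η) x v * (2 * inner ℝ (shapeOperator m (m + 1) φ η x (Y x))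
          (Z x) - normalTension φ η x * inner ℝ (Y x) (Z x))
        + 2 * normalTension φ η x
          * inner ℝ (nablaEnd (shapeOperator m (m + 1) φ η) x v Y) (Z x) := by
  have ht := mdiff_of_contMDiffAt (hη.contMDiffAt_normalTension hφ hU hx)
  have hA := hη.smoothAlongAt_shapeOperator hφ hU hx hY
  have h1 := mdiff_of_contMDiffAt (SmoothAlongAt.inner hY hZ)
  have h2 := mdiff_of_contMDiffAt (SmoothAlongAt.inner hA hZ)
  have h0 : (fun y => stressEnergy₂ m (m + 1) φ y (Y y) (Z y)) =ᶠ[𝓝 x]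
      fun y => normalTension φ η y * (normalTension φ η y * (-1 / 2 * inner ℝ (Y y) (Z y))
        + 2 * inner ℝ (shapeOperator m (m + 1) φ η y (Y y)) (Z y)) := by
    filter_upwards [hU.mem_nhds hx] with y hy
    rw [hη.stressEnergy₂_eq hφ hU hy]
    ring
  have hc (r : ℝ) : MDifferentiableAt (𝓡 m) 𝓘(ℝ, ℝ) (fun _ : M => r) x := mdifferentiableAt_const
  have hm {f g : M → ℝ} (hf : MDifferentiableAt (𝓡 m) 𝓘(ℝ, ℝ) f x)
      (hg : MDifferentiableAt (𝓡 m) 𝓘(ℝ, ℝ) g x) :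
      MDifferentiableAt (𝓡 m) 𝓘(ℝ, ℝ) (fun y => f y * g y) x := hf.mul hg
  have ha {f g : M → ℝ} (hf : MDifferentiableAt (𝓡 m) 𝓘(ℝ, ℝ) f x)
      (hg : MDifferentiableAt (𝓡 m) 𝓘(ℝ, ℝ) g x) :
      MDifferentiableAt (𝓡 m) 𝓘(ℝ, ℝ) (fun y => f y + g y) x := hf.add hg
  rw [nablaBilin, mvfderiv_congr h0, mvfderiv_mul_apply ht (ha (hm ht (hm (hc _) h1))
    (hm (hc _) h2)), mvfderiv_add_apply (hm ht (hm (hc _) h1)) (hm (hc _) h2),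
    mvfderiv_mul_apply ht (hm (hc _) h1), mvfderiv_mul_apply (hc _) h1,
    mvfderiv_mul_apply (hc _) h2, mvfderiv_inner_field hY.diffAlongAt hZ.diffAlongAt,
    mvfderiv_inner_field hA.diffAlongAt hZ.diffAlongAt, hη.stressEnergy₂_eq hφ hU hx,
    hη.stressEnergy₂_eq hφ hU hx, nablaEnd, inner_sub_left]
  simp only [mvfderiv_const, zero_apply]
  ring

/-- The connection form of an orthonormal frame is antisymmetric. -/
lemma IsOrthonormalFrameAt.sum_inner_leviCivita {E : Fin m → ∀ y : M, TangentSpace (𝓡 m) y}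
    (hE : IsOrthonormalFrameAt E x) {B : TangentSpace (𝓡 m) x → TangentSpace (𝓡 m) x}
    (hB : ∀ v w, (inner ℝ (B v) w : ℝ) = inner ℝ v (B w)) (v : TangentSpace (𝓡 m) x) :
    ∑ k, (inner ℝ (B (E k x)) (leviCivita (E k) x v) : ℝ) = 0 := by
  have hs (k) := (hE.smooth.self_of_nhds k).diffAlongAt
  have hω (j k) : (inner ℝ (E j x) (leviCivita (E k) x v) : ℝ)
      = -inner ℝ (E k x) (leviCivita (E j) x v) := by
    have h := mvfderiv_inner_field (hs j) (hs k) v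
    have h0 : (fun y => (inner ℝ (E j y) (E k y) : ℝ)) =ᶠ[𝓝 x] fun _ => if j = k then 1 else 0 := by
      filter_upwards [hE.orthonormal] with y hy
      rw [orthonormal_iff_ite.1 hy]
    rw [mvfderiv_congr h0, mvfderiv_const, real_inner_comm] at h
    simp only [zero_apply] at h
    linarith
  -- In the frame the sum contracts the symmetric matrix of `B` with the antisymmetric connection
  -- form, so it equals its own negative.
  have h1 : ∑ k, (inner ℝ (B (E k x)) (leviCivita (E k) x v) : ℝ)
      = ∑ k, ∑ j, (inner ℝ (B (E k x)) (E j x) : ℝ) * inner ℝ (E j x) (leviCivita (E k) x v) := by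
    refine Finset.sum_congr rfl fun k _ => ?_
    conv_lhs => rw [← sum_inner_smul hE.orthonormal.self_of_nhds (leviCivita (E k) x v)]
    simp only [inner_sum, real_inner_smul_right, mul_comm]
  have h2 : ∑ k, ∑ j, (inner ℝ (B (E k x)) (E j x) : ℝ) * inner ℝ (E j x) (leviCivita (E k) x v)
      = -∑ k, ∑ j, (inner ℝ (B (E k x)) (E j x) : ℝ)
        * inner ℝ (E j x) (leviCivita (E k) x v) := by
    conv_lhs => rw [Finset.sum_comm]
    simp only [← Finset.sum_neg_distrib]
    refine Finset.sum_congr rfl fun k _ => Finset.sum_congr rfl fun j _ => ?_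
    rw [hω, hB, real_inner_comm]
    ring
  linarith

/-- The trace of `∇A` is the derivative of the trace of `A`. -/
lemma IsUnitNormalOn.mvfderiv_normalTension (hη : IsUnitNormalOn m (m + 1) φ η U)
    (hφ : IsIsometricImmersion m (m + 1) φ) (hU : IsOpen U) (hx : x ∈ U)
    {E : Fin m → ∀ y : M, TangentSpace (𝓡 m) y} (hE : IsOrthonormalFrameAt E x)
    (v : TangentSpace (𝓡 m) x) :
    mvfderiv (𝓡 m) (normalTension φ η) x v
      = ∑ k, (inner ℝ (nablaEnd (shapeOperator m (m + 1) φ η) x v (E k)) (E k x) : ℝ) := by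
  have hs (k) := hE.smooth.self_of_nhds k
  have hA (k) := hη.smoothAlongAt_shapeOperator hφ hU hx (hs k)
  have h0 : normalTension φ η =ᶠ[𝓝 x]
      fun y => ∑ k, (inner ℝ (shapeOperator m (m + 1) φ η y (E k y)) (E k y) : ℝ) := by
    filter_upwards [hU.mem_nhds hx, hE.orthonormal] with y hy hy'
    exact hη.normalTension_eq_sum hφ hU hy hy'
  rw [mvfderiv_congr h0, (mvfderiv_sum_apply _
    (fun k => mdiff_of_contMDiffAt (SmoothAlongAt.inner (hA k) (hs k))) v).2]
  have hsymm := hη.shapeOperator_symm hφ hU hx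
  -- The derivative of `⟨A E_k, E_k⟩` exceeds `⟨(∇_v A) E_k, E_k⟩` by `2⟨A E_k, ∇_v E_k⟩`. The sum
  -- of these excesses is zero and is inserted with factor `-2`, so that the terms can be compared
  -- one by one.
  rw [← sub_zero (∑ k, (inner ℝ (nablaEnd _ x v (E k)) (E k x) : ℝ)), ← mul_zero (-2 : ℝ),
    ← hE.sum_inner_leviCivita hsymm v, Finset.mul_sum, ← Finset.sum_sub_distrib]
  refine Finset.sum_congr rfl fun k _ => ?_
  rw [mvfderiv_inner_field (hA k).diffAlongAt (hs k).diffAlongAt, nablaEnd, inner_sub_left,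
    hsymm (leviCivita (E k) x v), real_inner_comm (leviCivita (E k) x v)]
  ring

/-- The derivative of the squared norm of the shape operator. -/
lemma IsUnitNormalOn.mvfderiv_sum_norm_shapeOperator_sq (hη : IsUnitNormalOn m (m + 1) φ η U)
    (hφ : IsIsometricImmersion m (m + 1) φ) (hU : IsOpen U) (hx : x ∈ U)
    {E : Fin m → ∀ y : M, TangentSpace (𝓡 m) y} (hE : IsOrthonormalFrameAt E x)
    (v : TangentSpace (𝓡 m) x) :
    mvfderiv (𝓡 m) (fun y => ∑ k, (inner ℝ (shapeOperator m (m + 1) φ η y (E k y))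
        (shapeOperator m (m + 1) φ η y (E k y)) : ℝ)) x v
      = 2 * ∑ k, (inner ℝ (nablaEnd (shapeOperator m (m + 1) φ η) x v (E k))
        (shapeOperator m (m + 1) φ η x (E k x)) : ℝ) := by
  have hs (k) := hE.smooth.self_of_nhds k
  have hA (k) := hη.smoothAlongAt_shapeOperator hφ hU hx (hs k)
  have hsymm := hη.shapeOperator_symm hφ hU hx
  -- For `|A|²` the terms containing `∇_v E_k` contract the connection form with `A²`, which is
  -- again symmetric.
  have h0 := hE.sum_inner_leviCivita
    (B := fun v => shapeOperator m (m + 1) φ η x (shapeOperator m (m + 1) φ η x v))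
    (fun v w => by rw [hsymm, hsymm]) v
  rw [(mvfderiv_sum_apply _
    (fun k => mdiff_of_contMDiffAt (SmoothAlongAt.inner (hA k) (hA k))) v).2, ← sub_zero (2 * _),
    ← mul_zero (-2 : ℝ), ← h0, Finset.mul_sum, Finset.mul_sum, ← Finset.sum_sub_distrib]
  refine Finset.sum_congr rfl fun k _ => ?_
  rw [mvfderiv_inner_field (hA k).diffAlongAt (hA k).diffAlongAt, nablaEnd, inner_sub_left,
    hsymm (leviCivita (E k) x v), real_inner_comm _ (leviCivita (E k) x v),
    real_inner_comm _ (shapeOperator m (m + 1) φ η x (E k x))]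
  ring

end Hypersurface

/-! ### Functions with vanishing derivative on a connected manifold. -/

section LocallyConstant

variable {m : ℕ} {M : Type*} [TopologicalSpace M]
  [ChartedSpace (EuclideanSpace ℝ (Fin m)) M] [IsManifold (𝓡 m) ∞ M]

lemma eventually_eq_of_mvfderiv_eq_zero {f : M → ℝ} {x : M}
    (hf : ∀ᶠ y in 𝓝 x, MDifferentiableAt (𝓡 m) 𝓘(ℝ, ℝ) f y ∧ ∀ v, mvfderiv (𝓡 m) f y v = 0) :
    ∀ᶠ y in 𝓝 x, f y = f x := by
  have h1 : ∀ᶠ z in 𝓝 (extChartAt (𝓡 m) x x),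
      HasFDerivAt (f ∘ (extChartAt (𝓡 m) x).symm) (0 : EuclideanSpace ℝ (Fin m) →L[ℝ] ℝ) z := by
    have hc := continuousAt_extChartAt_symm (I := 𝓡 m) x
    rw [ContinuousAt, extChartAt_to_inv] at hc
    filter_upwards [hc.eventually hf,
      eventually_eventually_nhds.2 (extChartAt_target_mem_nhds (I := 𝓡 m) x)] with z hz hzt
    have hs : MDifferentiableAt 𝓘(ℝ, EuclideanSpace ℝ (Fin m)) (𝓡 m)
        (extChartAt (𝓡 m) x).symm z :=
      ((contMDiffOn_extChartAt_symm (I := 𝓡 m) (n := ∞) x).contMDiffAt hzt).mdifferentiableAt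
        (by simp)
    have h0 : mfderiv (𝓡 m) 𝓘(ℝ, ℝ) f ((extChartAt (𝓡 m) x).symm z) = 0 :=
      ContinuousLinearMap.ext hz.2
    have h := hz.1.hasMFDerivAt.comp z hs.hasMFDerivAt
    rw [h0, ContinuousLinearMap.zero_comp] at h
    exact hasMFDerivAt_iff_hasFDerivAt.1 h
  -- A ball in the chart is convex, so a vanishing derivative makes the local representative
  -- constant on it.
  obtain ⟨r, hr, hb⟩ := Metric.eventually_nhds_iff_ball.1 h1
  filter_upwards [(continuousAt_extChartAt (I := 𝓡 m) x).eventually (Metric.ball_mem_nhds _ hr),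
    extChartAt_source_mem_nhds (I := 𝓡 m) x] with y hy hys
  have h := (convex_ball (extChartAt (𝓡 m) x x) r).is_const_of_fderivWithin_eq_zero (𝕜 := ℝ)
    (fun z hz => (hb z hz).differentiableAt.differentiableWithinAt)
    (fun z hz => (hb z hz).hasFDerivWithinAt.fderivWithin (Metric.isOpen_ball.uniqueDiffWithinAt hz))
    hy (Metric.mem_ball_self hr)
  simpa only [Function.comp, (extChartAt (𝓡 m) x).left_inv hys, extChartAt_to_inv] using h

/-- A continuous function on a connected manifold whose derivative vanishes where the function does
not is constant. -/
theorem eq_of_mvfderiv_eq_zero [ConnectedSpace M] {f : M → ℝ} (hc : Continuous f)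
    (hf : ∀ y, f y ≠ 0 → MDifferentiableAt (𝓡 m) 𝓘(ℝ, ℝ) f y ∧ ∀ v, mvfderiv (𝓡 m) f y v = 0)
    {x : M} (hx : f x ≠ 0) (y : M) : f y = f x := by
  have h : IsClopen {y | f y = f x} := by
    refine ⟨isClosed_eq hc continuous_const, isOpen_iff_mem_nhds.2 fun z hz => ?_⟩
    -- On the level set `f` takes a nonzero value, so by continuity it is nonzero nearby and the
    -- derivative hypothesis is available on a neighbourhood.
    have hz' : f z ≠ 0 := fun h => hx (hz.symm.trans h)
    filter_upwards [eventually_eq_of_mvfderiv_eq_zero (m := m)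
      ((hc.continuousAt.eventually_ne hz').mono hf)] with w hw
    exact hw.trans hz
  exact (Set.ext_iff.1 (h.eq_univ ⟨x, rfl⟩) y).2 (mem_univ y)

end LocallyConstant

/-! ### The pointwise algebra behind the forward implication. -/

/-- If `t · T = d ⊗ (t/2 - a)` for the derivative `T` of a symmetric matrix `a` with trace `t`, and
`T` is totally symmetric with trace `d ≠ 0`, then `|a|² = t²`. -/
lemma sum_sq_eq_of_codazzi {ι : Type*} [Fintype ι] [DecidableEq ι] {t : ℝ} (ht : t ≠ 0)
    {a : ι → ι → ℝ} {T : ι → ι → ι → ℝ} {d : ι → ℝ} (ha : ∀ j k, a j k = a k j)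
    (hT : ∀ i j k, 2 * t * T i j k = d i * (t * (if j = k then 1 else 0) - 2 * a j k))
    (hC : ∀ i j k, T i j k = T j i k) (hd : ∀ i, ∑ j, T i j j = d i) (hta : ∑ j, a j j = t)
    {i : ι} (hi : d i ≠ 0) : ∑ j, ∑ k, a j k * a j k = t * t := by
  set b : ι → ι → ℝ := fun j k => t * (if j = k then 1 else 0) - 2 * a j k with hb
  have hbs (j k) : b j k = b k j := by simp only [hb, ha j k, eq_comm]
  have hbC (i j k) : d i * b j k = d j * b i k := by
    rw [← hT, hC, hT]
  -- Taking the trace of `2t T = d ⊗ b` over the last two indices gives `2t d i = d i (card ι - 2)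
  -- t`, which forces dimension four.
  have hcard : (Fintype.card ι : ℝ) = 4 := by
    have h1 : ∑ j, d i * b j j = ∑ j, 2 * t * T i j j :=
      Finset.sum_congr rfl fun j _ => (hT i j j).symm
    rw [← Finset.mul_sum, ← Finset.mul_sum, hd] at h1
    have h2 : ∑ j, b j j = Fintype.card ι * t - 2 * t := by
      simp [hb, Finset.sum_sub_distrib, ← Finset.mul_sum, hta]
    have h3 : d i * t * (Fintype.card ι - 4) = 0 := by rw [h2] at h1; linarith
    have := (mul_eq_zero.1 h3).resolve_left (mul_ne_zero hi ht)
    linarith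
  have htr : ∑ j, b j j = 2 * t := by
    simp only [hb, Finset.sum_sub_distrib, ← Finset.mul_sum, hta, if_true, Finset.sum_const,
      Finset.card_univ, nsmul_eq_mul, hcard]
    ring
  -- The relation `d i * b j k = d j * b i k` says that `b` is a multiple of `d ⊗ d`, so its
  -- two-by-two minors vanish. Summing gives `|b|² = (tr b)²`.
  have hsq (j k) : b j k * b j k = b j j * b k k := by
    have h1 := hbC i j k
    have h2 := hbC i k j
    have h3 := hbC i j j
    have h4 := hbC i k k
    rw [hbs k j] at h2
    refine mul_left_cancel₀ (mul_ne_zero hi hi) ?_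
    calc d i * d i * (b j k * b j k) = (d i * b j k) * (d i * b j k) := by ring
      _ = (d j * b i k) * (d k * b i j) := by rw [← h2, ← h1]
      _ = (d j * b i j) * (d k * b i k) := by ring
      _ = (d i * b j j) * (d i * b k k) := by rw [h3, h4]
      _ = _ := by ring
  have hsum : ∑ j, ∑ k, b j k * b j k = 2 * t * (2 * t) := by
    rw [← htr, Finset.sum_mul_sum]
    exact Finset.sum_congr rfl fun j _ => Finset.sum_congr rfl fun k _ => hsq j k
  -- In dimension four the sum of these terms is `4t² - 4t² + 4|a|²`, to be compared with `(tr b)² =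
  -- 4t²`.
  have hexp (j k) : b j k * b j k
      = (if j = k then t * t - 4 * t * a j k else 0) + 4 * (a j k * a j k) := by
    by_cases h : j = k
    · simp only [hb, h, if_true]; ring
    · simp only [hb, h, if_false]; ring
  simp only [hexp, Finset.sum_add_distrib, Finset.sum_ite_eq, Finset.mem_univ, if_true,
    Finset.sum_sub_distrib, ← Finset.mul_sum, hta, Finset.sum_const, Finset.card_univ,
    nsmul_eq_mul, hcard] at hsum
  linarith

/-! ### Consequences of `∇S₂ = 0`; nonvanishing of the tension field. -/

section Hypersurface

variable {m : ℕ} {N : Type*} [TopologicalSpace N]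
  [ChartedSpace (EuclideanSpace ℝ (Fin (m + 1))) N] [IsManifold (𝓡 (m + 1)) ∞ N]
  [RiemannianBundle (fun y : N => TangentSpace (𝓡 (m + 1)) y)]
  [IsContMDiffRiemannianBundle (𝓡 (m + 1)) ∞ (EuclideanSpace ℝ (Fin (m + 1)))
      (fun y : N => TangentSpace (𝓡 (m + 1)) y)]
  {M : Type*} [TopologicalSpace M]
  [ChartedSpace (EuclideanSpace ℝ (Fin m)) M] [IsManifold (𝓡 m) ∞ M]
  [RiemannianBundle (fun x : M => TangentSpace (𝓡 m) x)]
  [IsContMDiffRiemannianBundle (𝓡 m) ∞ (EuclideanSpace ℝ (Fin m))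
      (fun x : M => TangentSpace (𝓡 m) x)]

variable {φ : M → N} {x : M} {Y Z : ∀ y : M, TangentSpace (𝓡 m) y}
  {η : ∀ y : M, TangentSpace (𝓡 (m + 1)) (φ y)} {U : Set M}

lemma IsUnitNormalOn.inner_nablaEnd (hη : IsUnitNormalOn m (m + 1) φ η U)
    (hφ : IsIsometricImmersion m (m + 1) φ) (hS : StressEnergyParallel m (m + 1) φ)
    (hU : IsOpen U) (hx : x ∈ U) (hY : SmoothAlongAt m (fun y : M => y) Y x)
    (hZ : SmoothAlongAt m (fun y : M => y) Z x) (v : TangentSpace (𝓡 m) x) :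
    2 * normalTension φ η x * inner ℝ (nablaEnd (shapeOperator m (m + 1) φ η) x v Y) (Z x)
      = mvfderiv (𝓡 m) (normalTension φ η) x v * (normalTension φ η x * inner ℝ (Y x) (Z x)
        - 2 * inner ℝ (shapeOperator m (m + 1) φ η x (Y x)) (Z x)) := by
  have h := hS x v Y Z hY hZ
  rw [hη.nablaBilin_stressEnergy₂ hφ hU hx hY hZ] at h
  linarith

/-- `sum_sq_eq_of_codazzi` for the components of `A`, `∇A` and `dt` in the frame `E`. -/
lemma IsUnitNormalOn.sum_norm_shapeOperator_sq {c : ℝ} (hN : HasConstantCurvature (m + 1) N c)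
    (hη : IsUnitNormalOn m (m + 1) φ η U)
    (hφ : IsIsometricImmersion m (m + 1) φ) (hS : StressEnergyParallel m (m + 1) φ)
    (hU : IsOpen U) (hx : x ∈ U) {E : Fin m → ∀ y : M, TangentSpace (𝓡 m) y}
    (hE : IsOrthonormalFrameAt E x) (ht : normalTension φ η x ≠ 0) {i : Fin m}
    (hi : mvfderiv (𝓡 m) (normalTension φ η) x (E i x) ≠ 0) :
    ∑ k, (inner ℝ (shapeOperator m (m + 1) φ η x (E k x))
        (shapeOperator m (m + 1) φ η x (E k x)) : ℝ)
      = normalTension φ η x * normalTension φ η x := by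
  have hs (k) := hE.smooth.self_of_nhds k
  have he := hE.orthonormal.self_of_nhds
  rw [← sum_sq_eq_of_codazzi (t := normalTension φ η x) ht
    (a := fun j k => inner ℝ (shapeOperator m (m + 1) φ η x (E j x)) (E k x))
    (T := fun i j k => inner ℝ (nablaEnd (shapeOperator m (m + 1) φ η) x (E i x) (E j)) (E k x))
    (d := fun i => mvfderiv (𝓡 m) (normalTension φ η) x (E i x))
    (fun j k => by rw [hη.shapeOperator_symm hφ hU hx, real_inner_comm])
    (fun i j k => by
      rw [hη.inner_nablaEnd hφ hS hU hx (hs j) (hs k), orthonormal_iff_ite.1 he])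
    (fun i j k => by rw [hη.codazzi hN hφ hU hx (hs i) (hs j)])
    (fun i => (hη.mvfderiv_normalTension hφ hU hx hE _).symm)
    (hη.normalTension_eq_sum hφ hU hx he).symm hi]
  refine Finset.sum_congr rfl fun j _ => ?_
  conv_lhs => enter [3]; rw [← sum_inner_smul he (shapeOperator m (m + 1) φ η x (E j x))]
  simp only [inner_sum, real_inner_smul_right]
  refine Finset.sum_congr rfl fun k _ => ?_
  rw [real_inner_comm (E k x)]

/-- If `S₂` is parallel, the mean curvature is constant where it does not vanish. -/
theorem IsUnitNormalOn.mvfderiv_normalTension_eq_zero {c : ℝ}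
    (hN : HasConstantCurvature (m + 1) N c) (hη : IsUnitNormalOn m (m + 1) φ η U)
    (hφ : IsIsometricImmersion m (m + 1) φ) (hS : StressEnergyParallel m (m + 1) φ)
    (hU : IsOpen U) (hx : x ∈ U) (ht : normalTension φ η x ≠ 0) (v : TangentSpace (𝓡 m) x) :
    mvfderiv (𝓡 m) (normalTension φ η) x v = 0 := by
  by_contra hv
  obtain ⟨E, hE⟩ := exists_isOrthonormalFrameAt (n := m) x
  have hs (k) := hE.smooth.self_of_nhds k
  have he := hE.orthonormal.self_of_nhds
  have htd := hη.contMDiffAt_normalTension hφ hU hx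
  have htm := mdiff_of_contMDiffAt htd
  obtain ⟨i, hi⟩ : ∃ i, mvfderiv (𝓡 m) (normalTension φ η) x (E i x) ≠ 0 := by
    by_contra! h
    rw [← sum_inner_smul he v, map_sum] at hv
    exact hv (Finset.sum_eq_zero fun k _ => by rw [map_smul, h, smul_zero])
  -- The conditions `t ≠ 0` and `dt(E_i) ≠ 0` are open, so `|A|² = t²` holds on a neighbourhood and
  -- can be differentiated at `x`.
  have hev : (fun y => ∑ k, (inner ℝ (shapeOperator m (m + 1) φ η y (E k y))
        (shapeOperator m (m + 1) φ η y (E k y)) : ℝ))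
      =ᶠ[𝓝 x] fun y => normalTension φ η y * normalTension φ η y := by
    filter_upwards [hU.mem_nhds hx, hE.eventually, htd.continuousAt.eventually_ne ht,
      (contMDiffAt_mvfderiv htd (hs i)).continuousAt.eventually_ne hi] with y hy hEy hty hiy
    exact hη.sum_norm_shapeOperator_sq hN hφ hS hU hy hEy hty hiy
  have h1 := hη.mvfderiv_sum_norm_shapeOperator_sq hφ hU hx hE v
  rw [mvfderiv_congr hev, mvfderiv_mul_apply htm htm] at h1
  -- The identity for `∇A` paired with `A`: insert `Y = E_k` and `Z = A E_k`, then sum over `k`.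
  have h2 : normalTension φ η x * (2 * ∑ k, (inner ℝ
        (nablaEnd (shapeOperator m (m + 1) φ η) x v (E k))
        (shapeOperator m (m + 1) φ η x (E k x)) : ℝ))
      = mvfderiv (𝓡 m) (normalTension φ η) x v * (normalTension φ η x * normalTension φ η x
        - 2 * ∑ k, (inner ℝ (shapeOperator m (m + 1) φ η x (E k x))
          (shapeOperator m (m + 1) φ η x (E k x)) : ℝ)) := by
    -- One factor of `t²` becomes the trace of `A`, so that the identity splits into summands.
    nth_rewrite 3 [hη.normalTension_eq_sum hφ hU hx he]
    rw [Finset.mul_sum, Finset.mul_sum, Finset.mul_sum, Finset.mul_sum, ← Finset.sum_sub_distrib,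
      Finset.mul_sum]
    refine Finset.sum_congr rfl fun k _ => ?_
    have h := hη.inner_nablaEnd hφ hS hU hx (hs k)
      (hη.smoothAlongAt_shapeOperator hφ hU hx (hs k)) v
    rw [real_inner_comm _ (E k x)] at h
    linarith
  have h3 := hev.self_of_nhds
  simp only at h3
  rw [← h1, h3] at h2
  -- The two evaluations of `2t ⟨∇_v A, A⟩` are `2t² dt(v)` and `-t² dt(v)`.
  have h4 : normalTension φ η x * normalTension φ η x
      * mvfderiv (𝓡 m) (normalTension φ η) x v = 0 := by linarith
  exact hv ((mul_eq_zero.1 h4).resolve_left (mul_ne_zero ht ht))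

/-- Where the tension field does not vanish, it yields a unit normal field. -/
lemma isUnitNormalOn_tension (hφ : IsIsometricImmersion m (m + 1) φ) :
    IsUnitNormalOn m (m + 1) φ (fun y => ‖tension m (m + 1) φ y‖⁻¹ • tension m (m + 1) φ y)
      {y | tension m (m + 1) φ y ≠ 0} where
  smooth y hy :=
    have h := smoothAlongAt_tension hφ.smooth y
    (show SmoothAlongAt m φ (fun y => ‖tension m (m + 1) φ y‖⁻¹ • tension m (m + 1) φ y) y from
      SmoothAlongAt.smul (h.norm_inv hy) h).contMDiffWithinAt
  unit y hy := by
    rw [norm_smul, norm_inv, norm_norm, inv_mul_cancel₀ (norm_ne_zero_iff.2 hy)]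
  normal y _ v := by rw [real_inner_smul_right, real_inner_comm, inner_tension hφ, mul_zero]

lemma contMDiff_inner_tension (hφ : ContMDiff (𝓡 m) (𝓡 (m + 1)) ∞ φ) :
    ContMDiff (𝓡 m) 𝓘(ℝ, ℝ) ∞
      fun y => (inner ℝ (tension m (m + 1) φ y) (tension m (m + 1) φ y) : ℝ) :=
  fun y => SmoothAlongAt.inner (smoothAlongAt_tension hφ y) (smoothAlongAt_tension hφ y)

lemma isOpen_tension_ne_zero (hφ : ContMDiff (𝓡 m) (𝓡 (m + 1)) ∞ φ) :
    IsOpen {y | tension m (m + 1) φ y ≠ 0} := by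
  have h := (contMDiff_inner_tension hφ).continuous.isOpen_preimage _ (isOpen_ne (x := (0 : ℝ)))
  convert h using 1
  ext y
  simp

/-- If the mean curvature of a non-minimal hypersurface is locally constant where it does not
vanish, it vanishes nowhere. -/
lemma tension_ne_zero [ConnectedSpace M] (hφ : IsIsometricImmersion m (m + 1) φ)
    (hmin : ¬ IsMinimal m (m + 1) φ)
    (h : ∀ y, tension m (m + 1) φ y ≠ 0 → ∀ v, mvfderiv (𝓡 m) (normalTension φ
      fun y => ‖tension m (m + 1) φ y‖⁻¹ • tension m (m + 1) φ y) y v = 0) (x : M) :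
    tension m (m + 1) φ x ≠ 0 := by
  have hη := isUnitNormalOn_tension hφ
  have hU := isOpen_tension_ne_zero hφ.smooth
  obtain ⟨z, hz⟩ := not_forall.1 hmin
  have hz : tension m (m + 1) φ z ≠ 0 := fun h => hz (by rw [meanCurvature, h, smul_zero])
  -- The function `|τ|²` is smooth on all of `M`, including zeros of `τ`, where the normal `τ/|τ|`
  -- is not available.
  rw [← inner_self_ne_zero (𝕜 := ℝ)] at hz ⊢
  rwa [eq_of_mvfderiv_eq_zero (m := m) (contMDiff_inner_tension hφ.smooth).continuous
    (fun y hy => ⟨mdiff_of_contMDiffAt (contMDiff_inner_tension hφ.smooth y), fun v => ?_⟩) hz x]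
  have hy := inner_self_ne_zero.1 hy
  have ht := mdiff_of_contMDiffAt (hη.contMDiffAt_normalTension hφ hU hy)
  have hev : (fun y => (inner ℝ (tension m (m + 1) φ y) (tension m (m + 1) φ y) : ℝ)) =ᶠ[𝓝 y]
      fun y => normalTension φ (fun y => ‖tension m (m + 1) φ y‖⁻¹ • tension m (m + 1) φ y) y
        * normalTension φ (fun y => ‖tension m (m + 1) φ y‖⁻¹ • tension m (m + 1) φ y) y := by
    filter_upwards [hU.mem_nhds hy] with w hw
    rw [real_inner_self_eq_norm_sq, hη.norm_tension_sq hφ hw, sq]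
  rw [mvfderiv_congr hev, mvfderiv_mul_apply ht ht, h y hy, mul_zero, add_zero]

end Hypersurface

end RiemannianHypersurface

end

/-! ### The equivalence. -/

theorem mainTheorem10 {m : ℕ} (c : ℝ)
    {M : Type*} [TopologicalSpace M] [T2Space M] [ConnectedSpace M]
    [ChartedSpace (EuclideanSpace ℝ (Fin m)) M] [IsManifold (𝓡 m) ∞ M]
    [RiemannianBundle (fun x : M => TangentSpace (𝓡 m) x)]
    [IsContMDiffRiemannianBundle (𝓡 m) ∞ (EuclideanSpace ℝ (Fin m))
      (fun x : M => TangentSpace (𝓡 m) x)]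
    {N : Type*} [TopologicalSpace N] [T2Space N]
    [ChartedSpace (EuclideanSpace ℝ (Fin (m + 1))) N] [IsManifold (𝓡 (m + 1)) ∞ N]
    [RiemannianBundle (fun y : N => TangentSpace (𝓡 (m + 1)) y)]
    [IsContMDiffRiemannianBundle (𝓡 (m + 1)) ∞ (EuclideanSpace ℝ (Fin (m + 1)))
      (fun y : N => TangentSpace (𝓡 (m + 1)) y)]
    (hN : RiemannianHypersurface.HasConstantCurvature (m + 1) N c)
    (φ : M → N) (hφ : RiemannianHypersurface.IsIsometricImmersion m (m + 1) φ)
    (hmin : ¬ RiemannianHypersurface.IsMinimal m (m + 1) φ) :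
    RiemannianHypersurface.StressEnergyParallel m (m + 1) φ ↔
      RiemannianHypersurface.ShapeOperatorParallel m (m + 1) φ := by
  have hη := RiemannianHypersurface.isUnitNormalOn_tension hφ
  have hU₀ := RiemannianHypersurface.isOpen_tension_ne_zero hφ.smooth
  constructor
  · intro hS U η hU hηU x hx v Y hY
    -- The normal `τ/|τ|` serves only to show that `τ` has no zeros; the equation for `∇A` is then
    -- used with the given normal `η` on `U`.
    have hτ := RiemannianHypersurface.tension_ne_zero hφ hmin
      (fun y hy v => hη.mvfderiv_normalTension_eq_zero hN hφ hS hU₀ hy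
        (fun h => hy (by rw [hη.tension_eq hφ hy, h, zero_smul])) v) x
    have ht : RiemannianHypersurface.normalTension φ η x ≠ 0 := fun h =>
      hτ (by rw [hηU.tension_eq hφ hx, h, zero_smul])
    refine ext_inner_right ℝ fun w => ?_
    have h := hηU.inner_nablaEnd hφ hS hU hx hY
      (RiemannianHypersurface.eventually_smoothAlongAt_coordField x w).self_of_nhds v
    rw [hηU.mvfderiv_normalTension_eq_zero hN hφ hS hU hx ht, zero_mul,
      RiemannianHypersurface.coordField_self] at h
    rw [inner_zero_left]
    exact (mul_eq_zero.1 h).resolve_left (mul_ne_zero two_ne_zero ht)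
  · intro hA x v Y Z hY hZ
    have hdt (y : M) (hy : RiemannianHypersurface.tension m (m + 1) φ y ≠ 0)
        (v : TangentSpace (𝓡 m) y) : mvfderiv (𝓡 m) (RiemannianHypersurface.normalTension φ
          fun y => ‖RiemannianHypersurface.tension m (m + 1) φ y‖⁻¹ •
            RiemannianHypersurface.tension m (m + 1) φ y) y v = 0 := by
      obtain ⟨E, hE⟩ := RiemannianHypersurface.exists_isOrthonormalFrameAt (n := m) y
      -- `dt` is the trace of `∇A`, here for the normal `τ/|τ|`.
      rw [hη.mvfderiv_normalTension hφ hU₀ hy hE]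
      exact Finset.sum_eq_zero fun k _ => by
        rw [hA _ _ hU₀ hη y hy v (E k) (hE.smooth.self_of_nhds k), inner_zero_left]
    have hx := RiemannianHypersurface.tension_ne_zero hφ hmin hdt x
    rw [hη.nablaBilin_stressEnergy₂ hφ hU₀ hx hY hZ, hdt x hx, hA _ _ hU₀ hη x hx v Y hY,
      inner_zero_left, zero_mul, mul_zero, add_zero]
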